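/- Let $V$ be a finite set with $d\ge 1$ elements and let $\Gamma\in[0,\infty)^{V\times V}$ be symmetric with zero diagonal and $a^\top\Gamma a<0$ for all $a\in\mathbb R^V\setminus\{0\}$ with $\sum_i a_i=0$. For $I\subseteq V$ and $k\in I$ put $\Sigma^{(k)}_I=\tfrac12(\Gamma_{ik}+\Gamma_{jk}-\Gamma_{ij})_{i,j\in I\setminus\{k\}}$, let $\phi_p(\cdot\,;\Sigma)$ be the density of the centred $p$-dimensional normal distribution with covariance matrix $\Sigma$ ($\phi_0:=1$), and for $y\in(0,\infty)^V$ put $$\phi_I^{(k)}(y)=\phi_{|I|-1}\big((\log(y_i/y_k)+\Gamma_{ik}/2)_{i\in I\setminus\{k\}};\ \Sigma^{(k)}_I\big).$$ Let $\lambda(y)=y_k^{-2}\prod_{i\ne k}y_i^{-1}\,\phi_V^{(k)}(y)$ for some $k\in V$ be the Hüsler–Reiss exponent measure density on $[0,\infty)^V\setminus\{0\}$ (set to $0$, its limit, where some $y_i=0$), let $\mathcal L=\{y\in[0,\infty)^V:\|y\|_\infty>1\}$ and $\Lambda(\mathbf 1)=\int_{\mathcal L}\lambda(y)\,dy$. Let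 $Y$ be a random vector with the Hüsler–Reiss Pareto distribution, that is, with density $f_Y=\lambda/\Lambda(\mathbf 1)$ on $\mathcal L$. For disjoint $A,B,C$ with $A\cup B\cup C=V$ write $Y_A\perp_e Y_C\mid Y_B$ if for every $k\in V$ the vector $Y^k$, which is $Y$ conditioned on $\{Y_k>1\}$, has a density $f^k$ with $f^k(y)=f^k_{A\cup B}(y_{A\cup B})\,f^k_{B\cup C}(y_{B\cup C})/f^k_B(y_B)$ for almost every $y$, where $f^k_I$ denotes the marginal density of $Y^k_I$. Let $\mathcal G=(V,E)$ be a decomposable connected graph: $\mathcal G$ is connected and is either complete or has a proper decomposition $(A,B,C)$ ($V$ is the disjoint union of $A,B,C$, with $A,C\neq\emptyset$, $B$ complete, and $B$ separating $A$ from $C$) such that the induced subgraphs on $A\cup B$ and $B\cup C$ are again decomposable (not necessarily connected). Suppose that $Y$ satisfies the pairwise Markov property $Y_i\perp_e Y_j\mid Y_{V\setminus\{i,j\}}$ for all $i\ne j$ with $\{i,j\}\notin E$. Then the density of $Y$ factorizes as follows. There is an enumeration $C_1,\dots,C_m$ (without repetition) of all inclusion-maximal complete subsets of $V$ with the running intersection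 property, i.e. for every $i=2,\dots,m$ the set $D_i:=C_i\cap\bigcup_{j<i}C_j$ is contained in $C_l$ for some $l<i$, and there are $k_1\in C_1$ and $k_i\in D_i$, $i=2,\dots,m$. For every such enumeration and every such choice of $k_1,\dots,k_m$, $$f_Y(y)=\frac{y_{k_1}^{-2}\prod_{j\neq k_1}y_j^{-1}}{\Lambda(\mathbf 1)}\cdot\frac{\prod_{i=1}^m\phi_{C_i}^{(k_i)}(y)}{\prod_{i=2}^m\phi_{D_i}^{(k_i)}(y)},\qquad y\in\mathcal L,$$ where both sides are read as $0$ if some coordinate of $y$ is $0$. -/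

import Mathlib

open MeasureTheory ProbabilityTheory
open scoped ENNReal

noncomputable section

namespace ExtremalGraph

variable {V : Type*} [Fintype V] [DecidableEq V]

/-! ### Gaussian densities and Hüsler–Reiss Pareto distributions -/

/-- The density at `x` of the centred normal distribution on `ℝ^ι` with (invertible) covariance
matrix `S`. It equals `1` if `ι` is empty. -/
def gaussianDensity {ι : Type*} [Fintype ι] [DecidableEq ι] (S : Matrix ι ι ℝ) (x : ι → ℝ) : ℝ :=
  (Real.sqrt ((2 * Real.pi) ^ Fintype.card ι * S.det))⁻¹ *
    Real.exp (-(1 / 2) * (x ⬝ᵥ S⁻¹.mulVec x))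

/-- Variogram matrices: symmetric, zero diagonal, non-negative entries, strictly conditionally
negative definite. -/
structure IsVariogram (Γ : Matrix V V ℝ) : Prop where
  symm : Γ.IsSymm
  diag : ∀ i, Γ i i = 0
  nonneg : ∀ i j, 0 ≤ Γ i j
  neg : ∀ a : V → ℝ, a ≠ 0 → ∑ i, a i = 0 → a ⬝ᵥ Γ.mulVec a < 0

/-- The covariance matrix `Σ^{(k)}_I`, with index set `I \ {k}`. -/
def sigma (Γ : Matrix V V ℝ) (I : Finset V) (k : V) :
    Matrix {i // i ∈ I.erase k} {i // i ∈ I.erase k} ℝ :=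
  Matrix.of fun i j => (Γ i k + Γ j k - Γ i j) / 2

/-- The factor `φ_{|I|-1} (log (y_{I \ {k}} / y_k) + Γ_{I \ {k}, k} / 2 ; Σ^{(k)}_I)`,
for `k ∈ I`. -/
def phi (Γ : Matrix V V ℝ) (I : Finset V) (k : V) (y : V → ℝ) : ℝ :=
  gaussianDensity (sigma Γ I k) fun i => Real.log (y i / y k) + Γ i k / 2

/-- The Hüsler–Reiss exponent measure density `λ`, written with reference coordinate `k`.
It vanishes on the (Lebesgue null) faces of `[0,∞)^V`, since there one of the inverses is `0⁻¹ = 0`;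
this is also its limit there. -/
def hrLambda (Γ : Matrix V V ℝ) (k : V) (y : V → ℝ) : ℝ :=
  ((y k) ^ 2)⁻¹ * (∏ i ∈ Finset.univ.erase k, (y i)⁻¹) * phi Γ Finset.univ k y

/-- The punctured cone `[0,∞)^V \ {0}`. -/
def cone (V : Type*) : Set (V → ℝ) := {x | (∀ i, 0 ≤ x i) ∧ x ≠ 0}

/-- The `L`-shaped set of all `x` in the cone with `‖x‖_∞ > 1`. -/
def paretoSet (V : Type*) [Fintype V] : Set (V → ℝ) := {x | x ∈ cone V ∧ 1 < ‖x‖}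

/-- The Hüsler–Reiss exponent measure: Lebesgue density `λ` on the cone. -/
def hrExponentMeasure (Γ : Matrix V V ℝ) (k : V) : Measure (V → ℝ) :=
  (volume.restrict (cone V)).withDensity fun y => ENNReal.ofReal (hrLambda Γ k y)

/-- `Λ(z)`, the exponent measure of the complement of `[0,z]` in the cone. -/
def hrExponent (Γ : Matrix V V ℝ) (k : V) (z : V → ℝ) : ℝ :=
  (hrExponentMeasure Γ k).real (cone V \ Set.Icc 0 z)

/-- The Hüsler–Reiss Pareto density `f_Y = λ / Λ(1)` on the `L`-shaped set. -/
def hrParetoDensity (Γ : Matrix V V ℝ) (k : V) (y : V → ℝ) : ℝ :=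
  hrLambda Γ k y / hrExponent Γ k 1

/-- The Hüsler–Reiss Pareto distribution. -/
def hrPareto (Γ : Matrix V V ℝ) (k : V) : Measure (V → ℝ) :=
  (volume.restrict (paretoSet V)).withDensity fun y => ENNReal.ofReal (hrParetoDensity Γ k y)

/-! ### Conditional independence -/

/-- The marginal density `x ↦ f_I (x_I)`: all coordinates outside `I` are integrated out. -/
def marginalDensity (f : (V → ℝ) → ℝ≥0∞) (I : Finset V) : (V → ℝ) → ℝ≥0∞ :=
  lmarginal (fun _ => volume) Iᶜ f

/-- Conditional independence of `X_A` and `X_C` given `X_B` for a random vector `X` with law `ν`: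
`ν` has a Lebesgue density `f` with `f(x) = f_{A ∪ B}(x) f_{B ∪ C}(x) / f_B(x)` for almost all `x`
(if the support is a product set, both sides vanish outside of it). -/
def CondIndepLaw (ν : Measure (V → ℝ)) (A B C : Finset V) : Prop :=
  ∃ f : (V → ℝ) → ℝ≥0∞, Measurable f ∧ ν = volume.withDensity f ∧
    ∀ᵐ x ∂(volume : Measure (V → ℝ)),
      f x = marginalDensity f (A ∪ B) x * marginalDensity f (B ∪ C) x / marginalDensity f B x

variable {Ω : Type*} [MeasurableSpace Ω]

/-- Extremal conditional independence `Y_A ⊥ₑ Y_C ∣ Y_B`, for disjoint `A`, `B`, `C` with union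
`V`: for every `k`, the vector `Y^k`, that is `Y` conditioned on `Y_k > 1`, satisfies the usual
conditional independence. -/
def ExtremalCondIndep (P : Measure Ω) (Y : Ω → V → ℝ) (A B C : Finset V) : Prop :=
  ∀ k : V, CondIndepLaw ((cond P {ω | 1 < Y ω k}).map Y) A B C

/-- The extremal pairwise Markov property relative to the graph `G`. -/
def PairwiseMarkov (G : SimpleGraph V) (P : Measure Ω) (Y : Ω → V → ℝ) : Prop :=
  ∀ i j : V, i ≠ j → ¬ G.Adj i j → ExtremalCondIndep P Y {i} {i, j}ᶜ {j}

/-! ### Decomposable graphs, cliques and separators -/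

/-- In the subgraph of `G` induced by `U`, every walk from `A` to `C` meets `B`. -/
def Separates (G : SimpleGraph V) (U A B C : Finset V) : Prop :=
  ∀ a ∈ A, ∀ c ∈ C, ∀ p : G.Walk a c, (∀ v ∈ p.support, v ∈ U) → ∃ v ∈ p.support, v ∈ B

/-- The subgraph of `G` induced by a set of vertices is decomposable: it is complete, or it has a
proper decomposition `(A, B, C)` into two decomposable induced subgraphs. -/
inductive DecomposableOn (G : SimpleGraph V) : Finset V → Prop
  | complete (U : Finset V) (h : G.IsClique (U : Set V)) : DecomposableOn G U
  | decomposition (A B C : Finset V) (hAB : Disjoint A B) (hBC : Disjoint B C)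
      (hAC : Disjoint A C) (hA : A.Nonempty) (hC : C.Nonempty)
      (hB : G.IsClique (B : Set V)) (hsep : Separates G (A ∪ B ∪ C) A B C)
      (h₁ : DecomposableOn G (A ∪ B)) (h₂ : DecomposableOn G (B ∪ C)) :
      DecomposableOn G (A ∪ B ∪ C)

/-- Decomposable graphs. -/
def Decomposable (G : SimpleGraph V) : Prop := DecomposableOn G Finset.univ

/-- The separator `D_i = C_i ∩ ⋃_{j < i} C_j` (empty for the first index `0`). -/
def separator {m : ℕ} (C : Fin (m + 1) → Finset V) (i : Fin (m + 1)) : Finset V :=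
  C i ∩ (Finset.univ.filter (· < i)).biUnion C

/-- `C_0, …, C_m` lists every clique (inclusion-maximal complete set) of `G` exactly once and has
the running intersection property. -/
structure IsCliqueSequence (G : SimpleGraph V) {m : ℕ} (C : Fin (m + 1) → Finset V) : Prop where
  injective : Function.Injective C
  cliques : ∀ s : Finset V, (∃ i, C i = s) ↔ Maximal (fun t : Finset V => G.IsClique (t : Set V)) s
  rip : ∀ i, 0 < i → ∃ j < i, separator C i ⊆ C j

/-- Admissible reference vertices: `k_0 ∈ C_0`, and `k_i ∈ D_i` for the other indices. -/
def IsReference {m : ℕ} (C : Fin (m + 1) → Finset V) (k : Fin (m + 1) → V) : Prop :=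
  k 0 ∈ C 0 ∧ ∀ i, 0 < i → k i ∈ separator C i

/-- The factorized density, where `c` is the normalizing constant `Λ(1)`. -/
def factorizedDensity (Γ : Matrix V V ℝ) (c : ℝ) {m : ℕ} (C : Fin (m + 1) → Finset V)
    (k : Fin (m + 1) → V) (y : V → ℝ) : ℝ :=
  ((y (k 0)) ^ 2)⁻¹ * (∏ j ∈ Finset.univ.erase (k 0), (y j)⁻¹) / c *
    ((∏ i, phi Γ (C i) (k i) y) / ∏ i : Fin m, phi Γ (separator C i.succ) (k i.succ) y)

end ExtremalGraph

end

/-! For a vertex set I let N_I be -Γ/2 on I, bordered by a row and a column of ones with corner 0.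
Eliminating the border and one vertex k ∈ I from N_I leaves the covariance Σ_I^(k), and the
corresponding residual of the vector (1, log y) is exactly the argument of φ_I^(k). The eliminated
2×2 block contributes determinant -1 and quadratic form 2 log y_k. Hence φ_I^(k)(y) = y_k ψ_I(y),
where ψ_I is a Gaussian expression in N_I⁻¹ that does not involve k (`phi_eq`), and λ(y) = ψ_V(y) ∏
y_i⁻¹.

The Markov property gives zeros of N_V⁻¹. Conditional independence of i and j makes the density
multiplicatively modular on rectangles in these two directions. One rectangle inside (1,∞)^V
suffices: after taking logarithms, the mixed difference of the quadratic form is a nonzero multiple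
of (N_V⁻¹)_ij (`precisionSupported_univ`).

The zeros give the factorization. If W meets a complete set C and no edge joins W \ C to C \ W, then
the regression of C \ W on W only involves C ∩ W and the border. So ψ_{W∪C} ψ_{C∩W} = ψ_W ψ_C, and
N_W⁻¹ inherits the zeros prescribed by the graph (`psi_union`). Removing the last clique of the
sequence repeatedly factorizes ψ_V (`psi_biUnion`); the factors y_{k_i} cancel except for the first
one.

For existence, a decomposable graph grows from the empty set by adding simplicial vertices
(`DecomposableOn.reduces`), and each addition enlarges one clique of the list or appends a new one
(`exists_isCliqueSequenceOn`). Connectedness keeps the separators nonempty, so that reference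
vertices exist. -/

noncomputable section

namespace ExtremalGraph

open Matrix

/-! ### Schur complements and zero blocks of an inverse matrix -/

section SchurComplement

variable {U α β δ : Type*} [Fintype α] [DecidableEq α] [Fintype β] [DecidableEq β]
  [Fintype δ] [DecidableEq δ]

/-- The Schur complement in `N`, with rows and columns indexed through `g`, of the block indexed
through `f`. -/
def schur (N : Matrix U U ℝ) (f : α → U) (g : β → U) : Matrix β β ℝ :=
  N.submatrix g g - N.submatrix g f * (N.submatrix f f)⁻¹ * N.submatrix f g

/-- The residual of the coordinates indexed through `g` after regression on those indexed
through `f`. -/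
def residual (N : Matrix U U ℝ) (f : α → U) (g : β → U) (x : U → ℝ) : β → ℝ :=
  x ∘ g - (N.submatrix g f * (N.submatrix f f)⁻¹) *ᵥ (x ∘ f)

/-- The quadratic form of the inverse of the submatrix of `N` indexed through `f`. -/
def invQuad (N : Matrix U U ℝ) (f : α → U) (x : U → ℝ) : ℝ :=
  (x ∘ f) ⬝ᵥ (N.submatrix f f)⁻¹ *ᵥ (x ∘ f)

omit [Fintype α] [DecidableEq α] [Fintype β] [DecidableEq β] in
theorem submatrix_sumElim (N : Matrix U U ℝ) (f : α → U) (g : β → U) :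
    N.submatrix (Sum.elim f g) (Sum.elim f g) =
      fromBlocks (N.submatrix f f) (N.submatrix f g) (N.submatrix g f) (N.submatrix g g) := by
  ext (i | i) (j | j) <;> rfl

theorem det_submatrix_sumElim (N : Matrix U U ℝ) (f : α → U) (g : β → U)
    (hf : (N.submatrix f f).det ≠ 0) :
    (N.submatrix (Sum.elim f g) (Sum.elim f g)).det =
      (N.submatrix f f).det * (schur N f g).det := by
  have := invertibleOfIsUnitDet _ (isUnit_iff_ne_zero.2 hf)
  rw [submatrix_sumElim, det_fromBlocks₁₁, invOf_eq_nonsing_inv, schur]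

theorem inv_submatrix_sumElim (N : Matrix U U ℝ) (f : α → U) (g : β → U)
    (hf : (N.submatrix f f).det ≠ 0) (hS : (schur N f g).det ≠ 0) :
    (N.submatrix (Sum.elim f g) (Sum.elim f g))⁻¹ =
      fromBlocks
        ((N.submatrix f f)⁻¹ + (N.submatrix f f)⁻¹ * N.submatrix f g * (schur N f g)⁻¹ *
          N.submatrix g f * (N.submatrix f f)⁻¹)
        (-((N.submatrix f f)⁻¹ * N.submatrix f g * (schur N f g)⁻¹))
        (-((schur N f g)⁻¹ * N.submatrix g f * (N.submatrix f f)⁻¹))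
        (schur N f g)⁻¹ := by
  let := invertibleOfIsUnitDet _ (isUnit_iff_ne_zero.2 hf)
  let i2 := invertibleOfIsUnitDet _ (isUnit_iff_ne_zero.2 hS)
  have h0 : N.submatrix g g - N.submatrix g f * ⅟(N.submatrix f f) * N.submatrix f g =
      schur N f g := by rw [invOf_eq_nonsing_inv, schur]
  let : Invertible
      (N.submatrix g g - N.submatrix g f * ⅟(N.submatrix f f) * N.submatrix f g) :=
    i2.copy _ h0
  let := fromBlocks₁₁Invertible (N.submatrix f f) (N.submatrix f g) (N.submatrix g f)
    (N.submatrix g g)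
  rw [submatrix_sumElim, ← invOf_eq_nonsing_inv, invOf_fromBlocks₁₁_eq]
  simp only [invOf_eq_nonsing_inv, schur]

/-- Completing the square; no definiteness is used, which matters because the bordered matrix is
indefinite. -/
theorem invQuad_sumElim (N : Matrix U U ℝ) (hN : N.IsSymm) (f : α → U) (g : β → U)
    (hf : (N.submatrix f f).det ≠ 0) (hS : (schur N f g).det ≠ 0) (x : U → ℝ) :
    invQuad N (Sum.elim f g) x =
      invQuad N f x + residual N f g x ⬝ᵥ (schur N f g)⁻¹ *ᵥ residual N f g x := by
  have hx : x ∘ Sum.elim f g = Sum.elim (x ∘ f) (x ∘ g) := by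
    ext (i | i) <;> rfl
  have hA : ((N.submatrix f f)⁻¹)ᵀ = (N.submatrix f f)⁻¹ := by
    rw [transpose_nonsing_inv, transpose_submatrix, hN]
  have hB : (N.submatrix f g) = (N.submatrix g f)ᵀ := by
    rw [transpose_submatrix, hN]
  rw [invQuad, inv_submatrix_sumElim N f g hf hS, hx, fromBlocks_mulVec, invQuad, residual]
  set A := (N.submatrix f f)⁻¹
  set S := (schur N f g)⁻¹
  rw [hB]
  set C := N.submatrix g f
  set a := x ∘ f
  set b := x ∘ g
  have key : ∀ w : β → ℝ, a ⬝ᵥ (A * Cᵀ) *ᵥ w = (C * A) *ᵥ a ⬝ᵥ w := by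
    intro w
    rw [dotProduct_mulVec, ← mulVec_transpose, transpose_mul, transpose_transpose, hA]
  simp only [Sum.elim_comp_inl, Sum.elim_comp_inr, sumElim_dotProduct_sumElim, add_mulVec,
    neg_mulVec, dotProduct_add, dotProduct_neg, mulVec_sub, sub_dotProduct, dotProduct_sub]
  have e1 : a ⬝ᵥ (A * Cᵀ * S * C * A) *ᵥ a = (C * A) *ᵥ a ⬝ᵥ S *ᵥ ((C * A) *ᵥ a) := by
    rw [← key, mulVec_mulVec, mulVec_mulVec, Matrix.mul_assoc, Matrix.mul_assoc]
  have e2 : a ⬝ᵥ (A * Cᵀ * S) *ᵥ b = (C * A) *ᵥ a ⬝ᵥ S *ᵥ b := by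
    rw [← key, mulVec_mulVec]
  have e3 : b ⬝ᵥ (S * C * A) *ᵥ a = b ⬝ᵥ S *ᵥ ((C * A) *ᵥ a) := by
    rw [mulVec_mulVec, Matrix.mul_assoc]
  rw [e1, e2, e3]
  ring

omit [DecidableEq α] [Fintype β] [DecidableEq β] [DecidableEq δ] in
theorem mul_eq_of_inl_eq_zero {γ : Type*} {R : Matrix β (α ⊕ δ) ℝ}
    (hR : ∀ i j, R i (Sum.inl j) = 0) (M : Matrix (α ⊕ δ) γ ℝ) :
    R * M = R.submatrix id Sum.inr * M.submatrix Sum.inr id := by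
  ext i j
  simp [mul_apply, Fintype.sum_sum_type, hR]

/-- The zero block says that, once the `s`-coordinates are known, the `f`-coordinates do not help to
predict the `g`-coordinates. Regression on `f` and `s` is therefore regression on `s` alone. -/
theorem schur_and_residual_of_inv_eq_zero (N : Matrix U U ℝ) (f : α → U) (s : δ → U) (g : β → U)
    (hs : (N.submatrix s s).det ≠ 0)
    (hf : (N.submatrix (Sum.elim f s) (Sum.elim f s)).det ≠ 0)
    (hS : (schur N (Sum.elim f s) g).det ≠ 0)
    (h0 : ∀ i j, (N.submatrix (Sum.elim (Sum.elim f s) g) (Sum.elim (Sum.elim f s) g))⁻¹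
      (Sum.inr i) (Sum.inl (Sum.inl j)) = 0) :
    (∀ i j, (N.submatrix g (Sum.elim f s) *
        (N.submatrix (Sum.elim f s) (Sum.elim f s))⁻¹) i (Sum.inl j) = 0) ∧
      schur N (Sum.elim f s) g = schur N s g ∧
      residual N (Sum.elim f s) g = residual N s g := by
  set F := Sum.elim f s with hF
  set R := N.submatrix g F * (N.submatrix F F)⁻¹ with hR
  -- The lower left block of the inverse is -S⁻¹R with S the Schur complement; multiplying by S
  -- carries its zero columns over to R.
  have hR0 : ∀ i j, R i (Sum.inl j) = 0 := by
    have hz : ∀ i j, ((schur N F g)⁻¹ * R) i (Sum.inl j) = 0 := by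
      intro i j
      have := h0 i j
      rw [inv_submatrix_sumElim N F g hf hS, fromBlocks_apply₂₁, Matrix.mul_assoc, ← hR,
        neg_apply, neg_eq_zero] at this
      exact this
    intro i j
    have h1 : schur N F g * ((schur N F g)⁻¹ * R) = R :=
      mul_nonsing_inv_cancel_left _ _ (isUnit_iff_ne_zero.2 hS)
    rw [← h1, mul_apply]
    exact Finset.sum_eq_zero fun l _ => by rw [hz, mul_zero]
  have hRs : R.submatrix id Sum.inr = N.submatrix g s * (N.submatrix s s)⁻¹ := by
    have h1 : R * N.submatrix F F = N.submatrix g F :=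
      nonsing_inv_mul_cancel_right _ _ (isUnit_iff_ne_zero.2 hf)
    rw [mul_eq_of_inl_eq_zero hR0] at h1
    have h2 : R.submatrix id Sum.inr * N.submatrix s s = N.submatrix g s := by
      have := congrArg (fun M => M.submatrix id Sum.inr) h1
      ext i j
      exact congrFun (congrFun this i) j
    rw [← h2, mul_nonsing_inv_cancel_right _ _ (isUnit_iff_ne_zero.2 hs)]
  refine ⟨hR0, ?_, ?_⟩
  · rw [schur, schur, ← hR, mul_eq_of_inl_eq_zero hR0, hRs]
    rfl
  · funext x
    rw [residual, residual, ← hR, ← hRs]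
    congr 1
    ext i
    simp [mulVec, dotProduct, Fintype.sum_sum_type, hR0, hF]

/-- Under a conditional independence constraint on the inverse, determinants factorize. -/
theorem det_mul_det_of_inv_eq_zero (N : Matrix U U ℝ) (f : α → U) (s : δ → U) (g : β → U)
    (hs : (N.submatrix s s).det ≠ 0)
    (hf : (N.submatrix (Sum.elim f s) (Sum.elim f s)).det ≠ 0)
    (hS : (schur N (Sum.elim f s) g).det ≠ 0)
    (h0 : ∀ i j, (N.submatrix (Sum.elim (Sum.elim f s) g) (Sum.elim (Sum.elim f s) g))⁻¹
      (Sum.inr i) (Sum.inl (Sum.inl j)) = 0) :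
    (N.submatrix (Sum.elim (Sum.elim f s) g) (Sum.elim (Sum.elim f s) g)).det *
        (N.submatrix s s).det =
      (N.submatrix (Sum.elim f s) (Sum.elim f s)).det *
        (N.submatrix (Sum.elim s g) (Sum.elim s g)).det := by
  rw [det_submatrix_sumElim N _ g hf, det_submatrix_sumElim N s g hs,
    (schur_and_residual_of_inv_eq_zero N f s g hs hf hS h0).2.1]
  ring

theorem invQuad_add_invQuad_of_inv_eq_zero (N : Matrix U U ℝ) (hN : N.IsSymm)
    (f : α → U) (s : δ → U) (g : β → U)
    (hs : (N.submatrix s s).det ≠ 0)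
    (hf : (N.submatrix (Sum.elim f s) (Sum.elim f s)).det ≠ 0)
    (hS : (schur N (Sum.elim f s) g).det ≠ 0)
    (h0 : ∀ i j, (N.submatrix (Sum.elim (Sum.elim f s) g) (Sum.elim (Sum.elim f s) g))⁻¹
      (Sum.inr i) (Sum.inl (Sum.inl j)) = 0) (x : U → ℝ) :
    invQuad N (Sum.elim (Sum.elim f s) g) x + invQuad N s x =
      invQuad N (Sum.elim f s) x + invQuad N (Sum.elim s g) x := by
  obtain ⟨-, h1, h2⟩ := schur_and_residual_of_inv_eq_zero N f s g hs hf hS h0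
  rw [invQuad_sumElim N hN _ g hf hS, invQuad_sumElim N hN s g hs (h1 ▸ hS), h1, h2]
  ring

/-- Marginalization changes the inverse only inside the separator. -/
theorem inv_marginal_apply_of_inv_eq_zero (N : Matrix U U ℝ)
    (f : α → U) (s : δ → U) (g : β → U)
    (hs : (N.submatrix s s).det ≠ 0)
    (hf : (N.submatrix (Sum.elim f s) (Sum.elim f s)).det ≠ 0)
    (hS : (schur N (Sum.elim f s) g).det ≠ 0)
    (h0 : ∀ i j, (N.submatrix (Sum.elim (Sum.elim f s) g) (Sum.elim (Sum.elim f s) g))⁻¹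
      (Sum.inr i) (Sum.inl (Sum.inl j)) = 0) (i : α ⊕ δ) (j : α) :
    (N.submatrix (Sum.elim f s) (Sum.elim f s))⁻¹ i (Sum.inl j) =
      (N.submatrix (Sum.elim (Sum.elim f s) g) (Sum.elim (Sum.elim f s) g))⁻¹
        (Sum.inl i) (Sum.inl (Sum.inl j)) := by
  obtain ⟨h1, -, -⟩ := schur_and_residual_of_inv_eq_zero N f s g hs hf hS h0
  rw [inv_submatrix_sumElim N _ g hf hS, fromBlocks_apply₁₁, Matrix.add_apply,
    Matrix.mul_assoc _ _ (_ : Matrix _ _ ℝ)⁻¹, mul_apply, left_eq_add]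
  exact Finset.sum_eq_zero fun l _ => by rw [h1, mul_zero]

end SchurComplement

/-! ### Invariance under reindexing -/

section Reindex

variable {U α β : Type*} [Fintype α] [DecidableEq α] [Fintype β] [DecidableEq β]

theorem det_submatrix_equiv (N : Matrix U U ℝ) (e : α ≃ β) (f : β → U) :
    (N.submatrix (f ∘ e) (f ∘ e)).det = (N.submatrix f f).det := by
  rw [← submatrix_submatrix, det_submatrix_equiv_self]

theorem inv_submatrix_equiv_apply (N : Matrix U U ℝ) (e : α ≃ β) (f : β → U) (i j : α) :
    (N.submatrix (f ∘ e) (f ∘ e))⁻¹ i j = (N.submatrix f f)⁻¹ (e i) (e j) := by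
  rw [← submatrix_submatrix, inv_submatrix_equiv, submatrix_apply]

theorem invQuad_equiv (N : Matrix U U ℝ) (e : α ≃ β) (f : β → U) (x : U → ℝ) :
    invQuad N (f ∘ e) x = invQuad N f x := by
  rw [invQuad, invQuad, ← submatrix_submatrix, inv_submatrix_equiv, submatrix_mulVec_equiv]
  have h1 : (x ∘ f ∘ e) ∘ e.symm = x ∘ f := by ext; simp
  rw [h1]
  exact comp_equiv_dotProduct_comp_equiv (x ∘ f) _ e

end Reindex

/-! ### The bordered variogram matrix and the reference-free factor ψ -/

section Bordered

variable {V : Type*}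

/-- The matrix `-Γ / 2`, bordered by a row and a column of ones. -/
def border (Γ : Matrix V V ℝ) : Matrix (Option V) (Option V) ℝ :=
  Matrix.of fun a b => a.elim (b.elim 0 fun _ => 1) fun i => b.elim 1 fun j => -(Γ i j) / 2

/-- The vector `(1, log y)`. -/
def logVec (y : V → ℝ) (a : Option V) : ℝ := a.elim 1 fun i => Real.log (y i)

/-- The inclusion of the bordered index set of `I`. -/
def borderIdx (I : Finset V) : Option {i // i ∈ I} → Option V := Option.map Subtype.val

/-- The inclusion of `I` into the bordered index set. -/
def innerIdx (I : Finset V) (i : {i // i ∈ I}) : Option V := some i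

/-- The two indices given by the border and a reference vertex. -/
def refIdx (k : V) : Fin 2 → Option V := ![none, some k]

theorem border_isSymm {Γ : Matrix V V ℝ} (h : Γ.IsSymm) : (border Γ).IsSymm := by
  ext (_ | i) (_ | j) <;> simp [border, h.apply]

theorem exists_equiv_of_range_eq {U α β : Type*} {f : α → U} {f' : β → U}
    (hf : Function.Injective f) (hf' : Function.Injective f') (h : Set.range f = Set.range f') :
    ∃ e : α ≃ β, f = f' ∘ e := by
  refine ⟨(Equiv.ofInjective f hf).trans
    ((Equiv.setCongr h).trans (Equiv.ofInjective f' hf').symm), ?_⟩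
  funext a
  have := Equiv.apply_ofInjective_symm hf' ⟨f a, h ▸ Set.mem_range_self a⟩
  exact this.symm

theorem borderIdx_injective (I : Finset V) : Function.Injective (borderIdx I) :=
  Option.map_injective Subtype.val_injective

theorem innerIdx_injective (I : Finset V) : Function.Injective (innerIdx I) :=
  (Option.some_injective V).comp Subtype.val_injective

theorem mem_range_innerIdx (I : Finset V) (a : Option V) :
    a ∈ Set.range (innerIdx I) ↔ ∃ i ∈ I, a = some i := by
  simp [innerIdx, eq_comm]

theorem mem_range_borderIdx (I : Finset V) (a : Option V) :
    a ∈ Set.range (borderIdx I) ↔ a = none ∨ ∃ i ∈ I, a = some i := by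
  constructor
  · rintro ⟨_ | i, rfl⟩
    · exact .inl rfl
    · exact .inr ⟨i, i.2, rfl⟩
  · rintro (rfl | ⟨i, hi, rfl⟩)
    · exact ⟨none, rfl⟩
    · exact ⟨some ⟨i, hi⟩, rfl⟩

theorem exists_equiv_borderIdx {α : Type*} {I : Finset V} {f : α → Option V}
    (hf : Function.Injective f) (h : ∀ a, a ∈ Set.range f ↔ a = none ∨ ∃ i ∈ I, a = some i) :
    ∃ e : α ≃ Option {i // i ∈ I}, f = borderIdx I ∘ e :=
  exists_equiv_of_range_eq hf (borderIdx_injective I) <|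
    Set.ext fun a => (h a).trans (mem_range_borderIdx I a).symm

variable [DecidableEq V]

theorem exists_equiv_refIdx {I : Finset V} {k : V} (hk : k ∈ I) :
    ∃ e : Fin 2 ⊕ {i // i ∈ I.erase k} ≃ Option {i // i ∈ I},
      Sum.elim (refIdx k) (innerIdx (I.erase k)) = borderIdx I ∘ e := by
  apply exists_equiv_borderIdx
  · refine Function.Injective.sumElim ?_ (innerIdx_injective _) ?_
    · intro i j
      fin_cases i <;> fin_cases j <;> simp [refIdx]
    · rintro i ⟨j, hj⟩
      have := Finset.ne_of_mem_erase hj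
      fin_cases i <;> simp [refIdx, innerIdx, this.symm]
  · intro a
    rw [Set.Sum.elim_range, Set.mem_union, mem_range_innerIdx]
    simp only [refIdx, Matrix.range_cons, Matrix.range_empty, Set.union_empty, Set.mem_union,
      Set.mem_singleton_iff, Finset.mem_erase]
    constructor
    · rintro ((h | h) | ⟨i, hi, h⟩)
      · exact .inl h
      · exact .inr ⟨k, hk, h⟩
      · exact .inr ⟨i, hi.2, h⟩
    · rintro (h | ⟨i, hi, h⟩)
      · exact .inl (.inl h)
      · by_cases hik : i = k
        · exact .inl (.inr (hik ▸ h))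
        · exact .inr ⟨i, ⟨hik, hi⟩, h⟩

omit [DecidableEq V] in
theorem border_submatrix_refIdx {Γ : Matrix V V ℝ} {k : V} (h : Γ k k = 0) :
    (border Γ).submatrix (refIdx k) (refIdx k) = !![0, 1; 1, 0] := by
  ext i j
  fin_cases i <;> fin_cases j <;> simp [border, refIdx, h]

theorem inv_swap : (!![0, 1; 1, 0] : Matrix (Fin 2) (Fin 2) ℝ)⁻¹ = !![0, 1; 1, 0] := by
  apply inv_eq_left_inv
  ext i j
  fin_cases i <;> fin_cases j <;> simp

omit [DecidableEq V] in
theorem border_submatrix_mul_swap (Γ : Matrix V V ℝ) (k : V) (I : Finset V) :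
    (border Γ).submatrix (innerIdx I) (refIdx k) * (!![0, 1; 1, 0] : Matrix (Fin 2) (Fin 2) ℝ) =
      Matrix.of fun i : {i // i ∈ I} => ![-(Γ i k) / 2, 1] := by
  ext i j
  fin_cases j <;> simp [Matrix.mul_apply, Fin.sum_univ_two, border, refIdx, innerIdx]

theorem schur_border {Γ : Matrix V V ℝ} (hs : Γ.IsSymm) {k : V} (h : Γ k k = 0) (I : Finset V) :
    schur (border Γ) (refIdx k) (innerIdx (I.erase k)) = sigma Γ I k := by
  rw [schur, border_submatrix_refIdx h, inv_swap, border_submatrix_mul_swap]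
  ext i j
  rw [Matrix.sub_apply, Matrix.mul_apply, Fin.sum_univ_two]
  simp [border, refIdx, innerIdx, sigma, hs.apply j.1 k]
  ring

/-- The constant entry 1 of `logVec` meets the regression coefficient -Γ_ik/2; this is the source of
the shift Γ_ik/2 in φ. -/
theorem residual_border {Γ : Matrix V V ℝ} {k : V} (h : Γ k k = 0) (I : Finset V) (y : V → ℝ) :
    residual (border Γ) (refIdx k) (innerIdx (I.erase k)) (logVec y) =
      fun i : {i // i ∈ I.erase k} => Real.log (y i) - Real.log (y k) + Γ i k / 2 := by
  rw [residual, border_submatrix_refIdx h, inv_swap, border_submatrix_mul_swap]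
  ext i
  simp [Matrix.mulVec, dotProduct, Fin.sum_univ_two, refIdx, innerIdx, logVec]
  ring

omit [DecidableEq V] in
theorem invQuad_refIdx {Γ : Matrix V V ℝ} {k : V} (h : Γ k k = 0) (y : V → ℝ) :
    invQuad (border Γ) (refIdx k) (logVec y) = 2 * Real.log (y k) := by
  rw [invQuad, border_submatrix_refIdx h, inv_swap]
  simp [Matrix.mulVec, dotProduct, Fin.sum_univ_two, refIdx, logVec]
  ring

theorem sigma_posDef [Fintype V] {Γ : Matrix V V ℝ} (hΓ : IsVariogram Γ) (I : Finset V) (k : V) :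
    (sigma Γ I k).PosDef := by
  refine .of_dotProduct_mulVec_pos ?_ fun b hb => ?_
  · ext i j
    simp [sigma, hΓ.symm.apply i.1 j.1]
    ring
  set a : V → ℝ := fun v => if h : v ∈ I.erase k then b ⟨v, h⟩ else 0
  have ha (i : {i // i ∈ I.erase k}) : a i = b i := by simp only [a, dif_pos i.2]
  have hak : a k = 0 := by simp [a]
  have hsum (F : V → ℝ) : ∑ i, a i * F i = ∑ i : {i // i ∈ I.erase k}, b i * F i := by
    rw [← Finset.sum_subset (Finset.subset_univ (I.erase k)), ← Finset.sum_coe_sort]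
    · exact Finset.sum_congr rfl fun i _ => by rw [ha]
    · intro v _ hv
      simp only [a, dif_neg hv, zero_mul]
  set s : ℝ := ∑ i, a i with hsdef
  -- Extending `b` by zero and correcting its sum at `k` gives a zero-sum vector, on which the form
  -- of -Γ/2 takes the value bᵀΣb.
  set c : V → ℝ := a - Pi.single k s with hc
  have hc0 : ∑ i, c i = 0 := by simp [hc, hsdef]
  have hcne : c ≠ 0 := by
    obtain ⟨i, hi⟩ := Function.ne_iff.1 hb
    refine Function.ne_iff.2 ⟨i, ?_⟩
    simpa [hc, ha, Finset.ne_of_mem_erase i.2] using hi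
  have hneg := hΓ.neg c hcne hc0
  have hs' : s = ∑ i : {i // i ∈ I.erase k}, b i := by simpa using hsum 1
  have e1 : c ⬝ᵥ Γ *ᵥ c = a ⬝ᵥ Γ *ᵥ a - 2 * s * ∑ i, a i * Γ i k := by
    have h1 : Pi.single k s ⬝ᵥ Γ *ᵥ a = s * ∑ i, a i * Γ i k := by
      rw [single_dotProduct]
      congr 1
      exact Finset.sum_congr rfl fun i _ => by rw [mul_comm, hΓ.symm.apply]
    have h2 : a ⬝ᵥ Γ *ᵥ Pi.single k s = s * ∑ i, a i * Γ i k := by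
      rw [mulVec_single, dotProduct, Finset.mul_sum]
      exact Finset.sum_congr rfl fun i _ => by simp [Matrix.col_apply]; ring
    have h3 : Pi.single k s ⬝ᵥ Γ *ᵥ Pi.single k s = 0 := by
      rw [mulVec_single, single_dotProduct]
      simp [Matrix.col_apply, hΓ.diag]
    rw [hc, mulVec_sub, sub_dotProduct, dotProduct_sub, dotProduct_sub, h1, h2, h3]
    ring
  have e2 : a ⬝ᵥ Γ *ᵥ a = ∑ i : {i // i ∈ I.erase k}, ∑ j : {i // i ∈ I.erase k},
      b i * (b j * Γ i j) := by
    rw [dotProduct, hsum]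
    refine Finset.sum_congr rfl fun i _ => ?_
    rw [mulVec, dotProduct, ← Finset.mul_sum, ← hsum]
    simp only [mul_comm]
  have e3 : b ⬝ᵥ sigma Γ I k *ᵥ b = -(1 / 2) * (c ⬝ᵥ Γ *ᵥ c) := by
    rw [e1, e2, hsum, hs']
    simp only [dotProduct, mulVec, sigma, of_apply, Finset.mul_sum, Finset.sum_mul, mul_sub]
    have h4 : ∑ i : {i // i ∈ I.erase k}, ∑ j : {i // i ∈ I.erase k}, b i * (b j * Γ i k) =
        ∑ i : {i // i ∈ I.erase k}, ∑ j : {i // i ∈ I.erase k}, b i * (b j * Γ j k) := by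
      rw [Finset.sum_comm]
      exact Finset.sum_congr rfl fun i _ => Finset.sum_congr rfl fun j _ => by ring
    have h5 : ∀ i j : {i // i ∈ I.erase k}, b i * ((Γ i k + Γ j k - Γ i j) / 2 * b j) =
        1 / 2 * (b i * (b j * Γ i k)) + 1 / 2 * (b i * (b j * Γ j k))
          - 1 / 2 * (b i * (b j * Γ i j)) := fun i j => by ring
    have h6 : ∀ i j : {i // i ∈ I.erase k}, -(1 / 2) * (2 * b j * (b i * Γ i k)) =
        - (b i * (b j * Γ i k)) := fun i j => by ring
    simp only [h5, h6, Finset.sum_add_distrib, Finset.sum_sub_distrib,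
      Finset.sum_neg_distrib, ← Finset.mul_sum _ _ (1 / 2 : ℝ),
      ← Finset.mul_sum _ _ (-(1 / 2) : ℝ), h4]
    ring
  rw [star_trivial, e3]
  linarith

/-- Minus the determinant of the bordered matrix of `I`. -/
def borderDet (Γ : Matrix V V ℝ) (I : Finset V) : ℝ :=
  -((border Γ).submatrix (borderIdx I) (borderIdx I)).det

/-- The factor `φ_I^{(k)}(y) / y_k`, which does not depend on `k`. -/
def psi (Γ : Matrix V V ℝ) (I : Finset V) (y : V → ℝ) : ℝ :=
  (Real.sqrt ((2 * Real.pi) ^ (I.card - 1) * borderDet Γ I))⁻¹ *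
    Real.exp (-(1 / 2) * invQuad (border Γ) (borderIdx I) (logVec y))

theorem borderDet_eq [Fintype V] {Γ : Matrix V V ℝ} (hΓ : IsVariogram Γ) {I : Finset V} {k : V}
    (hk : k ∈ I) : borderDet Γ I = (sigma Γ I k).det := by
  obtain ⟨e, he⟩ := exists_equiv_refIdx hk
  have h : ((border Γ).submatrix (refIdx k) (refIdx k)).det = -1 := by
    rw [border_submatrix_refIdx (hΓ.diag k)]
    simp [det_fin_two]
  rw [borderDet, ← det_submatrix_equiv (border Γ) e, ← he, det_submatrix_sumElim, h,
    schur_border hΓ.symm (hΓ.diag k)]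
  · ring
  · rw [h]; norm_num

/-- Nonemptiness cannot be dropped: for `I = ∅` the bordered matrix is the 1×1 zero matrix. Hence
the later need for nonempty separators. -/
theorem borderDet_pos [Fintype V] {Γ : Matrix V V ℝ} (hΓ : IsVariogram Γ) {I : Finset V}
    (hI : I.Nonempty) : 0 < borderDet Γ I := by
  obtain ⟨k, hk⟩ := hI
  rw [borderDet_eq hΓ hk]
  exact (sigma_posDef hΓ I k).det_pos

theorem det_border_ne_zero [Fintype V] {Γ : Matrix V V ℝ} (hΓ : IsVariogram Γ) {I : Finset V}
    (hI : I.Nonempty) : ((border Γ).submatrix (borderIdx I) (borderIdx I)).det ≠ 0 :=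
  neg_ne_zero.1 (borderDet_pos hΓ hI).ne'

theorem psi_pos [Fintype V] {Γ : Matrix V V ℝ} (hΓ : IsVariogram Γ) {I : Finset V}
    (hI : I.Nonempty) (y : V → ℝ) : 0 < psi Γ I y := by
  have := borderDet_pos hΓ hI
  unfold psi
  positivity

/-- Splitting off the border and `k` from the quadratic form leaves the extra term 2 log y_k, whose
exponential factor exp(-log y_k) = y_k⁻¹ is the whole dependence on `k`. -/
theorem phi_eq [Fintype V] {Γ : Matrix V V ℝ} (hΓ : IsVariogram Γ) {I : Finset V} {k : V}
    (hk : k ∈ I) {y : V → ℝ} (hy : ∀ i, 0 < y i) : phi Γ I k y = y k * psi Γ I y := by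
  obtain ⟨e, he⟩ := exists_equiv_refIdx hk
  have h : ((border Γ).submatrix (refIdx k) (refIdx k)).det ≠ 0 := by
    rw [border_submatrix_refIdx (hΓ.diag k)]
    simp [det_fin_two]
  have hs := schur_border hΓ.symm (hΓ.diag k) I
  have hq : invQuad (border Γ) (borderIdx I) (logVec y) = 2 * Real.log (y k) +
      (fun i : {i // i ∈ I.erase k} => Real.log (y i / y k) + Γ i k / 2) ⬝ᵥ (sigma Γ I k)⁻¹ *ᵥ
        fun i : {i // i ∈ I.erase k} => Real.log (y i / y k) + Γ i k / 2 := by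
    rw [← invQuad_equiv _ e, ← he, invQuad_sumElim _ (border_isSymm hΓ.symm) _ _ h,
      invQuad_refIdx (hΓ.diag k), hs, residual_border (hΓ.diag k)]
    · simp only [Real.log_div (hy _).ne' (hy k).ne']
    · rw [hs]
      exact (sigma_posDef hΓ I k).det_pos.ne'
  rw [phi, gaussianDensity, psi, borderDet_eq hΓ hk, hq, Fintype.card_coe,
    Finset.card_erase_of_mem hk, mul_add, Real.exp_add]
  have : Real.exp (-(1 / 2) * (2 * Real.log (y k))) = (y k)⁻¹ := by
    rw [← Real.exp_log (inv_pos.2 (hy k)), Real.log_inv]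
    congr 1
    ring
  rw [this]
  have := (hy k).ne'
  field_simp

end Bordered

/-! ### Factorization of ψ along a clique sequence -/

section Factorization

variable {V : Type*} [DecidableEq V]

/-- `f` enumerates the bordered index set of `I`. -/
def EnumeratesBorder {α : Type*} (f : α → Option V) (I : Finset V) : Prop :=
  Function.Injective f ∧ ∀ a, a ∈ Set.range f ↔ a = none ∨ ∃ i ∈ I, a = some i

omit [DecidableEq V] in
theorem EnumeratesBorder.exists_equiv {α : Type*} {f : α → Option V} {I : Finset V}
    (h : EnumeratesBorder f I) : ∃ e : α ≃ Option {i // i ∈ I}, f = borderIdx I ∘ e :=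
  exists_equiv_borderIdx h.1 h.2

omit [DecidableEq V] in
theorem enumeratesBorder_borderIdx (I : Finset V) : EnumeratesBorder (borderIdx I) I :=
  ⟨borderIdx_injective I, mem_range_borderIdx I⟩

theorem EnumeratesBorder.sumElim_innerIdx {α : Type*} {f : α → Option V} {I J : Finset V}
    (h : EnumeratesBorder f I) (hIJ : Disjoint I J) :
    EnumeratesBorder (Sum.elim f (innerIdx J)) (I ∪ J) := by
  refine ⟨Function.Injective.sumElim h.1 (innerIdx_injective J) fun i j hij => ?_, fun a => ?_⟩
  · rcases (h.2 (f i)).1 ⟨i, rfl⟩ with h0 | ⟨l, hl, h0⟩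
    · simp [hij, innerIdx] at h0
    · rw [hij, innerIdx, Option.some_inj] at h0
      exact Finset.disjoint_left.1 hIJ hl (h0 ▸ j.2)
  · rw [Set.Sum.elim_range, Set.mem_union, h.2, mem_range_innerIdx]
    simp only [Finset.mem_union]
    grind

theorem EnumeratesBorder.innerIdx_sumElim {α : Type*} {f : α → Option V} {I J : Finset V}
    (h : EnumeratesBorder f I) (hIJ : Disjoint I J) :
    EnumeratesBorder (Sum.elim (innerIdx J) f) (J ∪ I) := by
  have h1 := h.sumElim_innerIdx hIJ
  have h2 : Sum.elim (innerIdx J) f = Sum.elim f (innerIdx J) ∘ Sum.swap := by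
    ext (i | i) <;> rfl
  rw [Finset.union_comm, h2]
  refine ⟨h1.1.comp Sum.swap_rightInverse.injective, fun a => ?_⟩
  rw [Sum.swap_leftInverse.surjective.range_comp]
  exact h1.2 a

variable [Fintype V]

/-- The precision matrix of the margin `W` vanishes at non-adjacent pairs. -/
def PrecisionSupported (Γ : Matrix V V ℝ) (G : SimpleGraph V) (W : Finset V) : Prop :=
  ∀ i j : {i // i ∈ W}, i ≠ j → ¬ G.Adj i j →
    ((border Γ).submatrix (borderIdx W) (borderIdx W))⁻¹ (some i) (some j) = 0

theorem psi_mul_psi {Γ : Matrix V V ℝ} (hΓ : IsVariogram Γ) {I J : Finset V} (hI : I.Nonempty)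
    (y z : V → ℝ) :
    psi Γ I y * psi Γ J z =
      (Real.sqrt ((2 * Real.pi) ^ ((I.card - 1) + (J.card - 1)) *
        (borderDet Γ I * borderDet Γ J)))⁻¹ *
        Real.exp (-(1 / 2) * (invQuad (border Γ) (borderIdx I) (logVec y) +
          invQuad (border Γ) (borderIdx J) (logVec z))) := by
  have := borderDet_pos hΓ hI
  rw [pow_add, mul_mul_mul_comm, Real.sqrt_mul (by positivity), mul_inv, mul_add, Real.exp_add,
    mul_mul_mul_comm]
  rfl

/-- Marginalizing out C \ W changes the precision matrix only at pairs inside C ∩ W and at the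
border. Completeness of `C` means that no zero is required at such pairs, so the support condition
survives and can feed an induction. -/
theorem psi_union {Γ : Matrix V V ℝ} (hΓ : IsVariogram Γ) {G : SimpleGraph V} {W C : Finset V}
    (hne : (C ∩ W).Nonempty) (hC : G.IsClique (C : Set V))
    (hsep : ∀ i ∈ C \ W, ∀ j ∈ W \ C, ¬ G.Adj i j)
    (hprec : PrecisionSupported Γ G (W ∪ C)) :
    PrecisionSupported Γ G W ∧
      ∀ y, psi Γ (W ∪ C) y * psi Γ (C ∩ W) y = psi Γ W y * psi Γ C y := by
  set N := border Γ
  have hN : N.IsSymm := border_isSymm hΓ.symm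
  have hW : W.Nonempty := hne.mono Finset.inter_subset_right
  have hCne : C.Nonempty := hne.mono Finset.inter_subset_left
  have hWC : (W ∪ C).Nonempty := hW.mono Finset.subset_union_left
  set f := innerIdx (W \ C)
  set s := borderIdx (C ∩ W)
  set g := innerIdx (C \ W)
  have h1 : EnumeratesBorder (Sum.elim f s) W := by
    have := (enumeratesBorder_borderIdx (C ∩ W)).innerIdx_sumElim (J := W \ C)
      (Finset.disjoint_left.2 (by grind))
    rwa [show W \ C ∪ C ∩ W = W by grind] at this
  have h2 : EnumeratesBorder (Sum.elim s g) C := by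
    have := (enumeratesBorder_borderIdx (C ∩ W)).sumElim_innerIdx (J := C \ W)
      (Finset.disjoint_left.2 (by grind))
    rwa [show C ∩ W ∪ C \ W = C by grind] at this
  have h3 : EnumeratesBorder (Sum.elim (Sum.elim f s) g) (W ∪ C) := by
    have := h1.sumElim_innerIdx (J := C \ W) (Finset.disjoint_left.2 (by grind))
    rwa [show W ∪ C \ W = W ∪ C by grind] at this
  obtain ⟨e1, he1⟩ := h1.exists_equiv
  obtain ⟨e2, he2⟩ := h2.exists_equiv
  obtain ⟨e3, he3⟩ := h3.exists_equiv
  have d1 : (N.submatrix (Sum.elim f s) (Sum.elim f s)).det = -borderDet Γ W := by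
    rw [he1, det_submatrix_equiv, borderDet, neg_neg]
  have d2 : (N.submatrix (Sum.elim s g) (Sum.elim s g)).det = -borderDet Γ C := by
    rw [he2, det_submatrix_equiv, borderDet, neg_neg]
  have d3 : (N.submatrix (Sum.elim (Sum.elim f s) g) (Sum.elim (Sum.elim f s) g)).det =
      -borderDet Γ (W ∪ C) := by
    rw [he3, det_submatrix_equiv, borderDet, neg_neg]
  have d0 : (N.submatrix s s).det = -borderDet Γ (C ∩ W) := by
    rw [borderDet, neg_neg]
  have hs : (N.submatrix s s).det ≠ 0 := det_border_ne_zero hΓ hne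
  have hf : (N.submatrix (Sum.elim f s) (Sum.elim f s)).det ≠ 0 := by
    rw [d1]; exact neg_ne_zero.2 (borderDet_pos hΓ hW).ne'
  have hS : (schur N (Sum.elim f s) g).det ≠ 0 := by
    have h := det_submatrix_sumElim N (Sum.elim f s) g hf
    rw [d3] at h
    intro h0
    rw [h0, mul_zero] at h
    exact neg_ne_zero.2 (borderDet_pos hΓ hWC).ne' h
  have hsome {i : {i // i ∈ W ∪ C}} {x : Option {i // i ∈ W ∪ C}}
      (h : some i.1 = borderIdx (W ∪ C) x) : x = some i :=
    (borderIdx_injective (W ∪ C) (a₁ := some i) (a₂ := x) h).symm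
  have hsome' {i : {i // i ∈ W}} {x : Option {i // i ∈ W}}
      (h : some i.1 = borderIdx W x) : x = some i :=
    (borderIdx_injective W (a₁ := some i) (a₂ := x) h).symm
  have h0 : ∀ i j, (N.submatrix (Sum.elim (Sum.elim f s) g) (Sum.elim (Sum.elim f s) g))⁻¹
      (Sum.inr i) (Sum.inl (Sum.inl j)) = 0 := by
    intro i j
    have hi := Finset.mem_sdiff.1 i.2
    have hj := Finset.mem_sdiff.1 j.2
    have ei : e3 (Sum.inr i) = some ⟨i, Finset.mem_union_right _ hi.1⟩ :=
      hsome (congrFun he3 (Sum.inr i))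
    have ej : e3 (Sum.inl (Sum.inl j)) = some ⟨j, Finset.mem_union_left _ hj.1⟩ :=
      hsome (congrFun he3 (Sum.inl (Sum.inl j)))
    rw [he3, inv_submatrix_equiv_apply, ei, ej]
    refine hprec _ _ (fun h => hi.2 ?_) (hsep _ i.2 _ j.2)
    rw [Subtype.mk.injEq] at h
    exact h ▸ hj.1
  constructor
  · have hcol : ∀ i j : {i // i ∈ W}, i ≠ j → ¬ G.Adj i j → j.1 ∉ C →
        (N.submatrix (borderIdx W) (borderIdx W))⁻¹ (some i) (some j) = 0 := by
      intro i j hij hadj hj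
      obtain ⟨i', hi'⟩ := e1.surjective (some i)
      have hfs : Sum.elim f s i' = some i.1 := by rw [he1, Function.comp_apply, hi']; rfl
      have ej : e1 (Sum.inl ⟨j, Finset.mem_sdiff.2 ⟨j.2, hj⟩⟩) = some j :=
        hsome' (congrFun he1 (Sum.inl ⟨j, Finset.mem_sdiff.2 ⟨j.2, hj⟩⟩))
      have e3i : e3 (Sum.inl i') = some ⟨i, Finset.mem_union_left _ i.2⟩ :=
        hsome (hfs.symm.trans (congrFun he3 (Sum.inl i')))
      have e3j : e3 (Sum.inl (Sum.inl ⟨j, Finset.mem_sdiff.2 ⟨j.2, hj⟩⟩)) =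
          some ⟨j, Finset.mem_union_left _ j.2⟩ :=
        hsome (congrFun he3 (Sum.inl (Sum.inl ⟨j, Finset.mem_sdiff.2 ⟨j.2, hj⟩⟩)))
      rw [← hi', ← ej, ← inv_submatrix_equiv_apply, ← he1,
        inv_marginal_apply_of_inv_eq_zero N f s g hs hf hS h0, he3, inv_submatrix_equiv_apply,
        e3i, e3j]
      refine hprec _ _ (fun h => hij ?_) hadj
      rw [Subtype.mk.injEq] at h
      exact Subtype.ext h
    intro i j hij hadj
    by_cases hj : j.1 ∈ C
    · by_cases hi : i.1 ∈ C
      · exact absurd (hC hi hj fun h => hij (Subtype.ext h)) hadj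
      · have hT : ((N.submatrix (borderIdx W) (borderIdx W))⁻¹)ᵀ =
            (N.submatrix (borderIdx W) (borderIdx W))⁻¹ := by
          rw [transpose_nonsing_inv, transpose_submatrix, hN]
        have := hcol j i hij.symm (fun h => hadj h.symm) hi
        rwa [← hT] at this
    · exact hcol i j hij hadj hj
  · intro y
    have hdet := det_mul_det_of_inv_eq_zero N f s g hs hf hS h0
    rw [d3, d0, d1, d2, neg_mul_neg, neg_mul_neg] at hdet
    have hq := invQuad_add_invQuad_of_inv_eq_zero N hN f s g hs hf hS h0 (logVec y)
    rw [he3, invQuad_equiv, he1, invQuad_equiv, he2, invQuad_equiv] at hq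
    -- The powers of 2π match by inclusion–exclusion; the subtractions are truncated, so all four
    -- sets must be nonempty.
    have hcard : ((W ∪ C).card - 1) + ((C ∩ W).card - 1) = (W.card - 1) + (C.card - 1) := by
      have := Finset.card_union_add_card_inter W C
      rw [Finset.inter_comm W C] at this
      have := hne.card_pos
      have := hW.card_pos
      have := hCne.card_pos
      have := hWC.card_pos
      omega
    rw [psi_mul_psi hΓ hWC, psi_mul_psi hΓ hW, hcard, hdet, hq]

omit [Fintype V] in
theorem mem_separator {m : ℕ} {C : Fin (m + 1) → Finset V} {i : Fin (m + 1)} {v : V} :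
    v ∈ separator C i ↔ v ∈ C i ∧ ∃ j < i, v ∈ C j := by
  simp [separator]

omit [Fintype V] in
theorem separator_comp_castSucc {m : ℕ} (C : Fin (m + 2) → Finset V) (i : Fin (m + 1)) :
    separator (C ∘ Fin.castSucc) i = separator C i.castSucc := by
  ext v
  rw [mem_separator, mem_separator]
  refine and_congr_right fun _ => ⟨fun ⟨j, hj, h⟩ => ⟨j.castSucc, by simpa using hj, h⟩, ?_⟩
  rintro ⟨j, hj, h⟩
  have hj' : j ≠ Fin.last _ := (hj.trans (Fin.castSucc_lt_last i)).ne
  refine ⟨j.castPred hj', ?_, by simpa using h⟩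
  rwa [← Fin.castSucc_lt_castSucc_iff, Fin.castSucc_castPred]

theorem psi_biUnion {Γ : Matrix V V ℝ} (hΓ : IsVariogram Γ) {G : SimpleGraph V} :
    ∀ {m : ℕ} (C : Fin (m + 1) → Finset V)
      (_ : ∀ i, G.IsClique (C i : Set V))
      (_ : ∀ i, 0 < i → ∃ j < i, separator C i ⊆ C j)
      (_ : ∀ i, 0 < i → (separator C i).Nonempty)
      (_ : ∀ v w, G.Adj v w → v ∈ Finset.univ.biUnion C → w ∈ Finset.univ.biUnion C →
        ∃ i, v ∈ C i ∧ w ∈ C i)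
      (_ : PrecisionSupported Γ G (Finset.univ.biUnion C)) (y : V → ℝ),
      psi Γ (Finset.univ.biUnion C) y * ∏ i : Fin m, psi Γ (separator C i.succ) y =
        ∏ i, psi Γ (C i) y := by
  intro m
  induction m with
  | zero =>
    intro C _ _ _ _ _ y
    have : Finset.univ.biUnion C = C 0 := by ext; simp
    rw [this]
    simp
  | succ m ih =>
    intro C hcl hrip hne hedge hprec y
    set C' : Fin (m + 1) → Finset V := C ∘ Fin.castSucc
    set W := Finset.univ.biUnion C'
    have hU : Finset.univ.biUnion C = W ∪ C (Fin.last _) := by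
      ext v
      simp [W, C', Fin.exists_fin_succ', or_comm]
    have hsep : separator C (Fin.last _) = C (Fin.last _) ∩ W := by
      ext v
      rw [mem_separator, Finset.mem_inter]
      refine and_congr_right fun _ => ?_
      simp only [W, C', Finset.mem_biUnion, Finset.mem_univ, true_and, Function.comp_apply]
      refine ⟨fun ⟨j, hj, h⟩ => ⟨j.castPred hj.ne, by simpa using h⟩,
        fun ⟨j, h⟩ => ⟨j.castSucc, Fin.castSucc_lt_last j, h⟩⟩
    have hedge' : ∀ v w, G.Adj v w → v ∈ W → w ∈ W → ∃ i, v ∈ C' i ∧ w ∈ C' i := by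
      intro v w hvw hv hw
      obtain ⟨i, hvi, hwi⟩ := hedge v w hvw (hU ▸ Finset.mem_union_left _ hv)
        (hU ▸ Finset.mem_union_left _ hw)
      induction i using Fin.lastCases with
      | cast i => exact ⟨i, hvi, hwi⟩
      | last =>
        -- An edge of the last clique with both ends in `W` lies in the last separator, hence by
        -- running intersection in an earlier clique.
        obtain ⟨j, hj, h⟩ := hrip (Fin.last _) (Fin.last_pos)
        rw [hsep] at h
        refine ⟨j.castPred hj.ne, ?_, ?_⟩
        · simpa [C'] using h (Finset.mem_inter.2 ⟨hvi, hv⟩)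
        · simpa [C'] using h (Finset.mem_inter.2 ⟨hwi, hw⟩)
    rw [hU] at hprec
    have hnadj : ∀ i ∈ C (Fin.last _) \ W, ∀ j ∈ W \ C (Fin.last _), ¬ G.Adj i j := by
      intro v hv w hw hvw
      rw [Finset.mem_sdiff] at hv hw
      obtain ⟨i, hvi, hwi⟩ := hedge v w hvw (hU ▸ Finset.mem_union_right _ hv.1)
        (hU ▸ Finset.mem_union_left _ hw.1)
      induction i using Fin.lastCases with
      | cast i => exact hv.2 (Finset.mem_biUnion.2 ⟨i, Finset.mem_univ _, hvi⟩)
      | last => exact hw.2 hwi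
    obtain ⟨hprec', hpsi⟩ := psi_union hΓ (hsep ▸ hne _ Fin.last_pos) (hcl _) hnadj hprec
    have hrip' : ∀ i, 0 < i → ∃ j < i, separator C' i ⊆ C' j := by
      intro i hi
      obtain ⟨j, hj, h⟩ := hrip i.castSucc (by simpa using hi)
      have hj' : j ≠ Fin.last _ := (hj.trans (Fin.castSucc_lt_last i)).ne
      refine ⟨j.castPred hj', ?_, ?_⟩
      · rwa [← Fin.castSucc_lt_castSucc_iff, Fin.castSucc_castPred]
      · rw [separator_comp_castSucc]
        simpa [C'] using h
    have hne' : ∀ i, 0 < i → (separator C' i).Nonempty := fun i hi => by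
      rw [separator_comp_castSucc]
      exact hne _ (by simpa using hi)
    have := ih C' (fun i => hcl _) hrip' hne' hedge' hprec' y
    rw [Fin.prod_univ_castSucc (n := m), Fin.prod_univ_castSucc (n := m + 1)]
    simp only [show ∀ i, separator C' i = separator C i.castSucc from
      separator_comp_castSucc C] at this
    rw [show ∏ i : Fin (m + 1), psi Γ (C i.castSucc) y = _ from this.symm, hU, Fin.succ_last, hsep]
    simp only [← Fin.succ_castSucc]
    linear_combination (∏ i : Fin m, psi Γ (separator C i.castSucc.succ) y) * hpsi y

end Factorization

/-! ### From the pairwise Markov property to zeros of the precision matrix -/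

section Markov

variable {V : Type*} [Fintype V] [DecidableEq V]

theorem hrLambda_eq {Γ : Matrix V V ℝ} (hΓ : IsVariogram Γ) (k : V) {y : V → ℝ}
    (hy : ∀ i, 0 < y i) : hrLambda Γ k y = (∏ i, (y i)⁻¹) * psi Γ Finset.univ y := by
  rw [hrLambda, phi_eq hΓ (Finset.mem_univ k) hy,
    ← Finset.mul_prod_erase _ _ (Finset.mem_univ k)]
  have := (hy k).ne'
  field_simp

theorem hrLambda_pos {Γ : Matrix V V ℝ} (hΓ : IsVariogram Γ) (k : V) {y : V → ℝ}
    (hy : ∀ i, 0 < y i) : 0 < hrLambda Γ k y := by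
  rw [hrLambda_eq hΓ k hy]
  exact mul_pos (Finset.prod_pos fun i _ => inv_pos.2 (hy i)) (psi_pos hΓ ⟨k, Finset.mem_univ k⟩ y)

theorem measurable_hrLambda (Γ : Matrix V V ℝ) (k : V) : Measurable (hrLambda Γ k) := by
  unfold hrLambda phi gaussianDensity
  simp only [dotProduct, mulVec]
  fun_prop

theorem measurable_hrParetoDensity (Γ : Matrix V V ℝ) (k : V) :
    Measurable (hrParetoDensity Γ k) :=
  (measurable_hrLambda Γ k).div_const _

omit [DecidableEq V] in
theorem measurableSet_paretoSet : MeasurableSet (paretoSet V) := by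
  have h : paretoSet V = (⋂ i, {x | 0 ≤ x i}) ∩ {0}ᶜ ∩ {x | 1 < ‖x‖} := by
    ext x
    simp [paretoSet, cone]
  rw [h]
  exact ((MeasurableSet.iInter fun i => measurableSet_le measurable_const
    (measurable_pi_apply i)).inter (MeasurableSet.singleton 0).compl).inter
      (measurableSet_lt measurable_const measurable_norm)

/-- The vectors with all coordinates larger than one. -/
def orthant (V : Type*) : Set (V → ℝ) := Set.univ.pi fun _ => Set.Ioi 1

omit [DecidableEq V] in
theorem orthant_subset_paretoSet [Nonempty V] : orthant V ⊆ paretoSet V := by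
  intro x hx
  have hx' : ∀ i, 1 < x i := fun i => hx i trivial
  obtain ⟨i⟩ := ‹Nonempty V›
  have h1 : 1 < ‖x‖ := (hx' i).trans_le ((le_abs_self _).trans (norm_le_pi_norm x i))
  refine ⟨⟨fun j => (zero_lt_one.trans (hx' j)).le, ?_⟩, h1⟩
  rintro rfl
  simp at h1
  linarith

omit [DecidableEq V] in
theorem volume_orthant_ne_zero : (volume : Measure (V → ℝ)) (orthant V) ≠ 0 := by
  refine (IsOpen.measure_pos volume (isOpen_set_pi Set.finite_univ fun _ _ => isOpen_Ioi)
    ⟨fun _ => 2, fun _ _ => ?_⟩).ne'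
  norm_num

/-- Conditional independence of coordinates `i` and `j` given the others makes the density
multiplicatively modular along every rectangle in the directions `i`, `j`. -/
theorem CondIndepLaw.ae_density_rectangle {ν : Measure (V → ℝ)} {i j : V} (hij : i ≠ j)
    (h : CondIndepLaw ν {i} {i, j}ᶜ {j}) (s t : ℝ) {g : (V → ℝ) → ℝ≥0∞} (hg : Measurable g)
    (hν : ν = volume.withDensity g) :
    ∀ᵐ x ∂(volume : Measure (V → ℝ)),
      g x * g (x + Pi.single i s + Pi.single j t) =
        g (x + Pi.single i s) * g (x + Pi.single j t) := by
  obtain ⟨f, hf, hfν, hfac⟩ := h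
  have hfg : f =ᵐ[volume] g :=
    (withDensity_eq_iff_of_sigmaFinite hf.aemeasurable hg.aemeasurable).1 (hfν.symm.trans hν)
  have hp := hfg.and hfac
  have hs (v : V → ℝ) := (quasiMeasurePreserving_add_right (volume : Measure (V → ℝ)) v).ae hp
  filter_upwards [hp, hs (Pi.single i s), hs (Pi.single j t),
    hs (Pi.single i s + Pi.single j t)] with x h0 h1 h2 h3
  rw [← add_assoc] at h3
  rw [← h0.1, ← h1.1, ← h2.1, ← h3.1, h0.2, h1.2, h2.2, h3.2]
  -- A marginal density ignores the coordinates integrated out. At the four corners this leaves the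
  -- same factors on both sides in a different order, so nothing has to be cancelled in `ℝ≥0∞`.
  have hm (I : Finset V) (x v : V → ℝ) (hv : ∀ l ∈ I, v l = 0) :
      marginalDensity f I (x + v) = marginalDensity f I x := by
    refine lmarginal_congr _ _ fun l hl => ?_
    rw [Pi.add_apply, hv l (by simpa using hl), add_zero]
  have hi : ∀ l ∈ ({i, j}ᶜ ∪ {j} : Finset V), Pi.single (M := fun _ => ℝ) i s l = 0 := by
    intro l hl
    refine Pi.single_eq_of_ne ?_ _
    simp only [Finset.mem_union, Finset.mem_compl, Finset.mem_insert, Finset.mem_singleton,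
      not_or] at hl
    rintro rfl
    simp [hij] at hl
  have hj : ∀ l ∈ ({i} ∪ {i, j}ᶜ : Finset V), Pi.single (M := fun _ => ℝ) j t l = 0 := by
    intro l hl
    refine Pi.single_eq_of_ne ?_ _
    simp only [Finset.mem_union, Finset.mem_compl, Finset.mem_insert, Finset.mem_singleton,
      not_or] at hl
    rintro rfl
    simp [hij.symm] at hl
  have hi' : ∀ l ∈ ({i, j}ᶜ : Finset V), Pi.single (M := fun _ => ℝ) i s l = 0 :=
    fun l hl => hi l (Finset.mem_union_left _ hl)
  have hj' : ∀ l ∈ ({i, j}ᶜ : Finset V), Pi.single (M := fun _ => ℝ) j t l = 0 :=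
    fun l hl => hj l (Finset.mem_union_right _ hl)
  simp only [hm _ _ _ hj, hm _ _ _ hj', hm _ _ _ hi']
  rw [add_right_comm, hm _ _ _ hi, hm _ _ _ hi]
  simp only [div_eq_mul_inv]
  ring

variable {Ω : Type*} [MeasurableSpace Ω]

theorem map_cond_eq_withDensity {Γ : Matrix V V ℝ} {k₀ : V} {P : Measure Ω} {Y : Ω → V → ℝ}
    (hY : HasLaw Y (hrPareto Γ k₀) P) (k : V) :
    (ProbabilityTheory.cond P {ω | 1 < Y ω k}).map Y = volume.withDensity
      ((P {ω | 1 < Y ω k})⁻¹ • ({x | 1 < x k} ∩ paretoSet V).indicator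
        fun y => ENNReal.ofReal (hrParetoDensity Γ k₀ y)) := by
  have hT : MeasurableSet {x : V → ℝ | 1 < x k} :=
    measurableSet_lt measurable_const (measurable_pi_apply k)
  have hd := (measurable_hrParetoDensity Γ k₀).ennreal_ofReal
  rw [withDensity_smul _ (hd.indicator (hT.inter measurableSet_paretoSet)),
    withDensity_indicator (hT.inter measurableSet_paretoSet), ProbabilityTheory.cond, Measure.map_smul,
    show {ω | 1 < Y ω k} = Y ⁻¹' {x | 1 < x k} from rfl,
    ← Measure.restrict_map_of_aemeasurable hY.aemeasurable hT, hY.map_eq, hrPareto,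
    restrict_withDensity hT, Measure.restrict_restrict hT]

/-- If Λ(1) were 0, division by zero would make the density, and with it the probability measure,
vanish. -/
theorem hrExponent_pos {Γ : Matrix V V ℝ} {k₀ : V} [IsProbabilityMeasure (hrPareto Γ k₀)] :
    0 < hrExponent Γ k₀ 1 := by
  refine lt_of_le_of_ne measureReal_nonneg fun h => ?_
  refine IsProbabilityMeasure.ne_zero (hrPareto Γ k₀) ?_
  simp [hrPareto, hrParetoDensity, ← h]

theorem hrPareto_orthant_ne_zero {Γ : Matrix V V ℝ} (hΓ : IsVariogram Γ) {k₀ : V}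
    (hc : 0 < hrExponent Γ k₀ 1) : hrPareto Γ k₀ (orthant V) ≠ 0 := by
  have : Nonempty V := ⟨k₀⟩
  have hd := (measurable_hrParetoDensity Γ k₀).ennreal_ofReal
  rw [hrPareto, Ne, withDensity_apply_eq_zero' hd.aemeasurable]
  intro h0
  refine volume_orthant_ne_zero (V := V) ?_
  rw [← Measure.restrict_eq_self _ (orthant_subset_paretoSet (V := V))]
  refine measure_mono_null (fun x hx => Set.mem_inter ?_ hx) h0
  have := hrLambda_pos hΓ k₀ fun i => zero_lt_one.trans (hx i trivial)
  simpa [hrParetoDensity] using div_pos this hc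

/-- The almost-everywhere identity holds somewhere in (1,∞)^V, a set of positive volume. Positive
shifts stay there, so the indicator is 1 at all four corners and the normalizing constants cancel.
-/
theorem hrLambda_rectangle {Γ : Matrix V V ℝ} (hΓ : IsVariogram Γ) {k₀ : V}
    {P : Measure Ω} [IsProbabilityMeasure P] {Y : Ω → V → ℝ}
    (hY : HasLaw Y (hrPareto Γ k₀) P) {i j : V} (hij : i ≠ j)
    (h : ExtremalCondIndep P Y {i} {i, j}ᶜ {j}) :
    ∃ x : V → ℝ, (∀ l, 1 < x l) ∧
      hrLambda Γ k₀ x * hrLambda Γ k₀ (x + Pi.single i 1 + Pi.single j 1) =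
        hrLambda Γ k₀ (x + Pi.single i 1) * hrLambda Γ k₀ (x + Pi.single j 1) := by
  have : Nonempty V := ⟨k₀⟩
  have : IsProbabilityMeasure (hrPareto Γ k₀) := hY.isProbabilityMeasure_iff.1 ‹_›
  have hc : 0 < hrExponent Γ k₀ 1 := hrExponent_pos
  have hT : MeasurableSet {x : V → ℝ | 1 < x k₀} :=
    measurableSet_lt measurable_const (measurable_pi_apply k₀)
  have hd := (measurable_hrParetoDensity Γ k₀).ennreal_ofReal
  set c := (P {ω | 1 < Y ω k₀})⁻¹ with hcdef
  have hc0 : c ≠ 0 := ENNReal.inv_ne_zero.2 (measure_ne_top _ _)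
  have hct : c ≠ ⊤ := by
    refine ENNReal.inv_ne_top.2 ?_
    rw [hY.measure_eq (p := fun x => 1 < x k₀) hT]
    exact fun h0 => hrPareto_orthant_ne_zero hΓ hc
      (measure_mono_null (fun x hx => hx k₀ trivial) h0)
  have hae := (h k₀).ae_density_rectangle hij 1 1
    ((hd.indicator (hT.inter measurableSet_paretoSet)).const_smul c)
    (map_cond_eq_withDensity hY k₀)
  obtain ⟨x, hx, hrect⟩ : ∃ x ∈ orthant V, _ := by
    by_contra! hcon
    exact volume_orthant_ne_zero (V := V) (measure_mono_null hcon (ae_iff.1 hae))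
  have hx1 : ∀ l, 1 < x l := fun l => hx l trivial
  refine ⟨x, hx1, ?_⟩
  have hsingle : ∀ i : V, (0 : V → ℝ) ≤ Pi.single i 1 := fun i => by simp
  have hval (z : V → ℝ) (hz : 0 ≤ z) :
      (c • ({x | 1 < x k₀} ∩ paretoSet V).indicator
        fun y => ENNReal.ofReal (hrParetoDensity Γ k₀ y)) (x + z) =
      c * ENNReal.ofReal (hrLambda Γ k₀ (x + z) / hrExponent Γ k₀ 1) ∧
      0 < hrLambda Γ k₀ (x + z) := by
    have hxz : ∀ l, 1 < (x + z) l := fun l => (hx1 l).trans_le (le_add_of_nonneg_right (hz l))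
    refine ⟨?_, hrLambda_pos hΓ k₀ fun l => zero_lt_one.trans (hxz l)⟩
    have hmem : x + z ∈ {x : V → ℝ | 1 < x k₀} ∩ paretoSet V :=
      ⟨hxz k₀, orthant_subset_paretoSet fun l _ => hxz l⟩
    rw [Pi.smul_apply, Set.indicator_of_mem hmem, smul_eq_mul, hrParetoDensity]
  obtain ⟨e0, p0⟩ := hval 0 le_rfl
  obtain ⟨e1, p1⟩ := hval _ (hsingle i)
  obtain ⟨e2, p2⟩ := hval _ (hsingle j)
  obtain ⟨e3, p3⟩ := hval _ (add_nonneg (hsingle i) (hsingle j))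
  rw [add_zero] at e0 p0
  rw [← add_assoc] at e3 p3
  rw [e0, e1, e2, e3, mul_mul_mul_comm, mul_mul_mul_comm c _ c,
    ENNReal.mul_right_inj (mul_ne_zero hc0 hc0) (ENNReal.mul_ne_top hct hct),
    ← ENNReal.ofReal_mul (by positivity), ← ENNReal.ofReal_mul (by positivity),
    ENNReal.ofReal_eq_ofReal_iff (by positivity) (by positivity)] at hrect
  field_simp at hrect
  exact hrect

theorem precisionSupported_univ {Γ : Matrix V V ℝ} (hΓ : IsVariogram Γ) {k₀ : V}
    {G : SimpleGraph V} {P : Measure Ω} [IsProbabilityMeasure P] {Y : Ω → V → ℝ}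
    (hY : HasLaw Y (hrPareto Γ k₀) P) (hmarkov : PairwiseMarkov G P Y) :
    PrecisionSupported Γ G Finset.univ := by
  intro i' j' hij' hadj
  obtain ⟨i, hi⟩ := i'
  obtain ⟨j, hj⟩ := j'
  have hij : i ≠ j := fun h => hij' (Subtype.ext h)
  obtain ⟨x, hx, hrect⟩ := hrLambda_rectangle hΓ hY hij (hmarkov i j hij hadj)
  have hsingle : ∀ i l : V, (0 : ℝ) ≤ Pi.single (M := fun _ => ℝ) i 1 l := fun i l => by
    rw [Pi.single_apply]
    split_ifs <;> norm_num
  have hpos (z : V → ℝ) (hz : ∀ l, 0 ≤ z l) : ∀ l, 0 < (x + z) l := fun l =>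
    add_pos_of_pos_of_nonneg (zero_lt_one.trans (hx l)) (hz l)
  have p0 : ∀ l, 0 < x l := fun l => zero_lt_one.trans (hx l)
  have p1 := hpos _ (hsingle i)
  have p2 := hpos _ (hsingle j)
  have p3 : ∀ l, 0 < (x + Pi.single i 1 + Pi.single j 1 : V → ℝ) l := fun l =>
    add_pos_of_pos_of_nonneg (p1 l) (hsingle j l)
  rw [hrLambda_eq hΓ k₀ p0, hrLambda_eq hΓ k₀ p1, hrLambda_eq hΓ k₀ p2, hrLambda_eq hΓ k₀ p3,
    mul_mul_mul_comm, mul_mul_mul_comm _ (psi Γ Finset.univ (x + Pi.single i 1))] at hrect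
  have hprod : (∏ l, (x l)⁻¹) * ∏ l, ((x + Pi.single i 1 + Pi.single j 1 : V → ℝ) l)⁻¹ =
      (∏ l, ((x + Pi.single i 1 : V → ℝ) l)⁻¹) * ∏ l, ((x + Pi.single j 1 : V → ℝ) l)⁻¹ := by
    rw [← Finset.prod_mul_distrib, ← Finset.prod_mul_distrib]
    refine Finset.prod_congr rfl fun l _ => ?_
    by_cases hl : l = i
    · simp [Pi.single_eq_of_ne (hl.trans_ne hij), mul_comm]
    · simp [Pi.single_eq_of_ne hl]
  have hne : (Finset.univ : Finset V).Nonempty := ⟨k₀, Finset.mem_univ _⟩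
  have hp : 0 < (∏ l, ((x + Pi.single i 1 : V → ℝ) l)⁻¹) * ∏ l, ((x + Pi.single j 1 : V → ℝ) l)⁻¹ :=
    mul_pos (Finset.prod_pos fun l _ => inv_pos.2 (p1 l))
      (Finset.prod_pos fun l _ => inv_pos.2 (p2 l))
  have hdet := borderDet_pos hΓ hne
  rw [hprod, mul_right_inj' hp.ne', psi_mul_psi hΓ hne, psi_mul_psi hΓ hne,
    mul_right_inj' (by positivity), Real.exp_eq_exp] at hrect
  set ι : Option {l // l ∈ (Finset.univ : Finset V)} → Option V := borderIdx Finset.univ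
  -- On the logarithmic scale, raising one coordinate by 1 adds a positive multiple of a basis
  -- vector.
  have hlog (z : V → ℝ) (l : V) (hl : l ∈ Finset.univ) (hz : 0 < z l) :
      logVec (z + Pi.single l 1) ∘ ι =
        logVec z ∘ ι + Pi.single (some ⟨l, hl⟩) (Real.log ((z l + 1) / z l)) := by
    ext (_ | a)
    · simp [ι, logVec, borderIdx]
    · by_cases ha : a = ⟨l, hl⟩
      · subst ha
        simp [ι, logVec, borderIdx, Real.log_div (add_pos hz one_pos).ne' hz.ne']
      · have ha' : a.1 ≠ l := fun h => ha (Subtype.ext h)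
        simp [ι, logVec, borderIdx, Pi.single_apply, ha, ha']
  have hT : (((border Γ).submatrix ι ι)⁻¹)ᵀ = ((border Γ).submatrix ι ι)⁻¹ := by
    rw [transpose_nonsing_inv, transpose_submatrix, border_isSymm hΓ.symm]
  have hxj : (x + Pi.single i 1 : V → ℝ) j = x j := by simp [Pi.single_eq_of_ne hij.symm]
  simp only [invQuad, hlog _ j hj (p1 j), hlog _ i hi (p0 i), hlog _ j hj (p0 j), hxj] at hrect
  set K := ((border Γ).submatrix ι ι)⁻¹
  set s := Real.log ((x i + 1) / x i) with hs
  set t := Real.log ((x j + 1) / x j) with ht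
  have hs0 : 0 < s := Real.log_pos <| by rw [one_lt_div (p0 i)]; linarith
  have ht0 : 0 < t := Real.log_pos <| by rw [one_lt_div (p0 j)]; linarith
  have hsymm : K (some ⟨j, hj⟩) (some ⟨i, hi⟩) = K (some ⟨i, hi⟩) (some ⟨j, hj⟩) := by
    conv_lhs => rw [← hT, transpose_apply]
  have hKij : Pi.single (some ⟨i, hi⟩) s ⬝ᵥ K *ᵥ Pi.single (some ⟨j, hj⟩) t =
      s * t * K (some ⟨i, hi⟩) (some ⟨j, hj⟩) := by
    rw [mulVec_single, single_dotProduct]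
    simp [Matrix.col_apply]
    ring
  have hKji : Pi.single (some ⟨j, hj⟩) t ⬝ᵥ K *ᵥ Pi.single (some ⟨i, hi⟩) s =
      s * t * K (some ⟨i, hi⟩) (some ⟨j, hj⟩) := by
    rw [mulVec_single, single_dotProduct, ← hsymm]
    simp [Matrix.col_apply]
    ring
  -- Everything but the two equal cross terms cancels in the mixed difference.
  simp only [mulVec_add, add_dotProduct, dotProduct_add, hKij, hKji] at hrect
  have hz : s * t * K (some ⟨i, hi⟩) (some ⟨j, hj⟩) = 0 := by linarith
  exact (mul_eq_zero.1 hz).resolve_left (mul_pos hs0 ht0).ne'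

end Markov

/-! ### Simplicial elimination and existence of clique sequences -/

section Cliques

variable {V : Type*} [DecidableEq V]

/-- `U` can be reduced to `Q` by removing simplicial vertices one at a time. -/
inductive Reduces (G : SimpleGraph V) (Q : Finset V) : Finset V → Prop
  | refl : Reduces G Q Q
  | insert (v : V) (U : Finset V) (hv : v ∉ U) (hcl : G.IsClique {w | w ∈ U ∧ G.Adj v w})
      (h : Reduces G Q U) : Reduces G Q (insert v U)

theorem Reduces.trans {G : SimpleGraph V} {Q R U : Finset V} (h₁ : Reduces G Q R)
    (h₂ : Reduces G R U) : Reduces G Q U := by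
  induction h₂ with
  | refl => exact h₁
  | insert v U hv hcl _ ih => exact .insert v U hv hcl ih

theorem Reduces.subset {G : SimpleGraph V} {Q U : Finset V} (h : Reduces G Q U) : Q ⊆ U := by
  induction h with
  | refl => exact subset_rfl
  | insert v U _ _ _ ih => exact ih.trans (Finset.subset_insert v U)

/-- The vertices added on the way from `Q` to `U` have no neighbours in `A`, so they stay simplicial
when `A` is present. -/
theorem Reduces.union_left {G : SimpleGraph V} {A Q U : Finset V} (h : Reduces G Q U)
    (hA : Disjoint A U) (hadj : ∀ a ∈ A, ∀ u ∈ U, u ∉ Q → ¬ G.Adj a u) :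
    Reduces G (A ∪ Q) (A ∪ U) := by
  induction h with
  | refl => exact .refl
  | insert v U hv hcl h ih =>
    rw [Finset.union_insert]
    have hvQ : v ∉ Q := fun h' => hv (h.subset h')
    have hvA : v ∉ A := fun h' => Finset.disjoint_left.1 hA h' (Finset.mem_insert_self v U)
    refine .insert v _ (by simp [hvA, hv]) ?_
      (ih (hA.mono_right (Finset.subset_insert v U)) fun a ha u hu =>
        hadj a ha u (Finset.mem_insert_of_mem hu))
    refine hcl.subset ?_
    rintro w ⟨hw, hvw⟩
    rcases Finset.mem_union.1 hw with hw | hw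
    · exact absurd hvw.symm (hadj w hw v (Finset.mem_insert_self v U) hvQ)
    · exact ⟨hw, hvw⟩

theorem reduces_of_isClique {G : SimpleGraph V} {Q U : Finset V} (hU : G.IsClique (U : Set V))
    (hQ : Q ⊆ U) : Reduces G Q U := by
  suffices h : ∀ S : Finset V, Disjoint S Q → S ⊆ U → Reduces G Q (S ∪ Q) by
    have := h (U \ Q) Finset.sdiff_disjoint Finset.sdiff_subset
    rwa [Finset.sdiff_union_of_subset hQ] at this
  intro S
  induction S using Finset.induction_on with
  | empty => exact fun _ _ => by simpa using Reduces.refl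
  | insert v S hv ih =>
    intro hdis hsub
    rw [Finset.insert_union]
    refine .insert v _ ?_ ?_ (ih (hdis.mono_left (Finset.subset_insert v S))
      ((Finset.subset_insert v S).trans hsub))
    · rw [Finset.mem_union, not_or]
      exact ⟨hv, Finset.disjoint_left.1 hdis (Finset.mem_insert_self v S)⟩
    · refine hU.subset fun w hw => ?_
      rcases Finset.mem_union.1 hw.1 with h | h
      · exact hsub (Finset.mem_insert_of_mem h)
      · exact hQ h

/-- The freedom in `Q` makes the induction close. A complete `Q` lies in one side of the
decomposition; that side is built from `Q`, and the other side is then attached starting from the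
complete set `B`. -/
theorem DecomposableOn.reduces {G : SimpleGraph V} {U : Finset V} (h : DecomposableOn G U) :
    ∀ {Q : Finset V}, G.IsClique (Q : Set V) → Q ⊆ U → Reduces G Q U := by
  induction h with
  | complete U hU => exact fun _ hQ => reduces_of_isClique hU hQ
  | decomposition A B C hAB hBC hAC hA hC hB hsep h₁ h₂ ih₁ ih₂ =>
    intro Q hQ hQU
    have hadj : ∀ a ∈ A, ∀ c ∈ C, ¬ G.Adj a c := by
      intro a ha c hc hac
      obtain ⟨v, hv, hvB⟩ := hsep a ha c hc hac.toWalk (by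
        intro v hv
        simp only [SimpleGraph.Walk.support_cons, SimpleGraph.Walk.support_nil, List.mem_cons,
          List.not_mem_nil, or_false, SimpleGraph.Adj.toWalk] at hv
        rcases hv with rfl | rfl
        · simp [ha]
        · simp [hc])
      simp only [SimpleGraph.Walk.support_cons, SimpleGraph.Walk.support_nil, List.mem_cons,
        List.not_mem_nil, or_false, SimpleGraph.Adj.toWalk] at hv
      rcases hv with rfl | rfl
      · exact Finset.disjoint_left.1 hAB ha hvB
      · exact Finset.disjoint_left.1 hBC hvB hc
    by_cases hQA : Q ⊆ A ∪ B
    · refine (ih₁ hQ hQA).trans ?_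
      have := (ih₂ hB Finset.subset_union_left).union_left (A := A)
        (Finset.disjoint_union_right.2 ⟨hAB, hAC⟩) fun a ha u hu huB =>
          hadj a ha u ((Finset.mem_union.1 hu).resolve_left huB)
      rwa [← Finset.union_assoc] at this
    · have hQC : Q ⊆ B ∪ C := by
        obtain ⟨c, hcQ, hc⟩ := Finset.not_subset.1 hQA
        have hcC : c ∈ C := by have := hQU hcQ; grind
        intro v hv
        by_contra hv'
        have hvA : v ∈ A := by have := hQU hv; grind
        exact hadj v hvA c hcC (hQ hv hcQ fun h => hv' (h ▸ Finset.mem_union_right _ hcC))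
      refine (ih₂ hQ hQC).trans ?_
      have := (ih₁ hB Finset.subset_union_right).union_left (A := C)
        (Finset.disjoint_union_right.2 ⟨hAC.symm, hBC.symm⟩) fun c hc u hu huB h =>
          hadj u ((Finset.mem_union.1 hu).resolve_right huB) c hc h.symm
      rwa [Finset.union_comm C B, show C ∪ (A ∪ B) = A ∪ B ∪ C from Finset.union_comm _ _] at this

/-- `C` lists the maximal complete subsets of `U` and has the running intersection property. -/
structure IsCliqueSequenceOn (G : SimpleGraph V) (U : Finset V) {m : ℕ}
    (C : Fin (m + 1) → Finset V) : Prop where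
  injective : Function.Injective C
  cliques : ∀ s : Finset V, (∃ i, C i = s) ↔
    Maximal (fun t : Finset V => t ⊆ U ∧ G.IsClique (t : Set V)) s
  rip : ∀ i, 0 < i → ∃ j < i, separator C i ⊆ C j

/-- Every cut of `U` is crossed by an edge. -/
def CutConnected (G : SimpleGraph V) (U : Finset V) : Prop :=
  ∀ S ⊆ U, S.Nonempty → S ≠ U → ∃ s ∈ S, ∃ t ∈ U \ S, G.Adj s t

/-- An edge leaving `S ∪ {v}` through `v` can be replaced by one from a neighbour of `v` in `S`,
since the neighbours of `v` are pairwise adjacent. If `v` has no neighbour in `S`, an edge leaving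
`S` avoids `v` anyway. -/
theorem CutConnected.of_insert {G : SimpleGraph V} {U : Finset V} {v : V}
    (h : CutConnected G (insert v U)) (hv : v ∉ U)
    (hcl : G.IsClique {w | w ∈ U ∧ G.Adj v w}) : CutConnected G U := by
  intro S hS hne hSU
  by_cases hvS : ∃ s ∈ S, G.Adj v s
  · obtain ⟨s', hs', hvs'⟩ := hvS
    obtain ⟨s, hs, t, ht, hst⟩ := h (insert v S) (Finset.insert_subset_insert v hS)
      (Finset.insert_nonempty v S) (fun h' => hSU (by
        rw [← Finset.erase_insert hv, ← h', Finset.erase_insert fun h => hv (hS h)]))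
    have ht' : t ∈ U ∧ t ∉ S := by grind
    rcases Finset.mem_insert.1 hs with rfl | hs
    · refine ⟨s', hs', t, Finset.mem_sdiff.2 ht', hcl ⟨hS hs', hvs'⟩ ⟨ht'.1, hst⟩ ?_⟩
      rintro rfl
      exact ht'.2 hs'
    · exact ⟨s, hs, t, Finset.mem_sdiff.2 ht', hst⟩
  · obtain ⟨s, hs, t, ht, hst⟩ := h S (hS.trans (Finset.subset_insert v U)) hne
      (fun h' => hv (hS (h' ▸ Finset.mem_insert_self v U)))
    refine ⟨s, hs, t, ?_, hst⟩
    have : t ≠ v := by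
      rintro rfl
      exact hvS ⟨s, hs, hst.symm⟩
    grind

theorem cutConnected_univ [Fintype V] {G : SimpleGraph V} (h : G.Connected) :
    CutConnected G Finset.univ := by
  rintro S - ⟨s, hs⟩ hSU
  obtain ⟨t, ht⟩ : ∃ t, t ∉ S := by
    by_contra! h'
    exact hSU (Finset.eq_univ_iff_forall.2 h')
  obtain ⟨p⟩ := h.preconnected s t
  obtain ⟨d, -, h1, h2⟩ := p.exists_boundary_dart (S : Set V) hs ht
  exact ⟨d.fst, h1, d.snd, by simpa using h2, d.adj⟩

/-- Adding a simplicial vertex `v` with neighbourhood `N` creates the one new clique N ∪ {v} and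
destroys at most the old clique `N`. The list starts with the single clique ∅ of the empty graph. -/
theorem exists_isCliqueSequenceOn {G : SimpleGraph V} {U : Finset V} (h : Reduces G ∅ U) :
    ∃ (m : ℕ) (C : Fin (m + 1) → Finset V), IsCliqueSequenceOn G U C ∧
      (CutConnected G U → ∀ i, 0 < i → (separator C i).Nonempty) := by
  classical
  induction h with
  | refl =>
    refine ⟨0, fun _ => ∅, ⟨fun _ _ _ => Subsingleton.elim (α := Fin 1) _ _, fun s => ?_, ?_⟩, ?_⟩
    · constructor
      · rintro ⟨_, rfl⟩
        exact ⟨⟨subset_rfl, by simp⟩, fun t ht _ => ht.1⟩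
      · exact fun hs => ⟨0, (Finset.subset_empty.1 hs.prop.1).symm⟩
    · intro i hi
      exact absurd hi (by simp [Subsingleton.elim (α := Fin 1) i 0])
    · intro _ i hi
      exact absurd hi (by simp [Subsingleton.elim (α := Fin 1) i 0])
  | insert v U hv hcl h ih =>
    obtain ⟨m, C, hC, hne⟩ := ih
    set N : Finset V := U.filter (G.Adj v) with hN
    have hNU : N ⊆ U := Finset.filter_subset _ _
    have hNcl : G.IsClique (N : Set V) := by
      refine hcl.subset fun w hw => ?_
      simpa [hN] using hw
    have hvN : v ∉ N := fun h => hv (hNU h)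
    have hCU : ∀ i, C i ⊆ U := fun i => ((hC.cliques _).1 ⟨i, rfl⟩).prop.1
    have hCcl : ∀ i, G.IsClique (C i : Set V) := fun i => ((hC.cliques _).1 ⟨i, rfl⟩).prop.2
    have hvC : ∀ i, v ∉ C i := fun i h => hv (hCU i h)
    have hcover : ∀ t : Finset V, t ⊆ U → G.IsClique (t : Set V) → ∃ i, t ⊆ C i := by
      intro t htU htc
      obtain ⟨s, hts, hs⟩ := (U.powerset.filter fun t : Finset V =>
        G.IsClique (t : Set V)).exists_le_maximal (a := t) (by simp [htU, htc])
      have hs' : Maximal (fun t : Finset V => t ⊆ U ∧ G.IsClique (t : Set V)) s := by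
        refine ⟨by simpa using hs.prop, fun t' ht' => hs.le_of_ge (by simpa using ht')⟩
      obtain ⟨i, rfl⟩ := (hC.cliques s).2 hs'
      exact ⟨i, hts⟩
    have hsubN : ∀ t : Finset V, v ∈ t → t ⊆ insert v U → G.IsClique (t : Set V) →
        t ⊆ insert v N := by
      intro t hvt htU htc w hw
      by_cases hwv : w = v
      · exact hwv ▸ Finset.mem_insert_self _ _
      · refine Finset.mem_insert_of_mem (Finset.mem_filter.2 ⟨?_, ?_⟩)
        · exact Finset.mem_of_mem_insert_of_ne (htU hw) hwv
        · exact htc hvt hw fun h => hwv h.symm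
    have hvNcl : G.IsClique ((insert v N : Finset V) : Set V) := by
      rw [Finset.coe_insert, SimpleGraph.isClique_insert]
      exact ⟨hNcl, fun w hw _ => (Finset.mem_filter.1 hw).2⟩
    have hvNmax : Maximal (fun t : Finset V => t ⊆ insert v U ∧ G.IsClique (t : Set V))
        (insert v N) :=
      ⟨⟨Finset.insert_subset_insert v hNU, hvNcl⟩, fun t ht hle =>
        hsubN t (hle (Finset.mem_insert_self v N)) ht.1 ht.2⟩
    have hmax : ∀ s : Finset V,
        Maximal (fun t : Finset V => t ⊆ insert v U ∧ G.IsClique (t : Set V)) s ↔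
          s = insert v N ∨ (s ≠ N ∧ ∃ i, C i = s) := by
      intro s
      constructor
      · intro hs
        by_cases hvs : v ∈ s
        · exact .inl ((hsubN s hvs hs.prop.1 hs.prop.2).antisymm
            (hs.le_of_ge hvNmax.prop (hsubN s hvs hs.prop.1 hs.prop.2)))
        · refine .inr ⟨?_, (hC.cliques s).2 ⟨⟨fun w hw => ?_, hs.prop.2⟩, fun t ht hle => ?_⟩⟩
          · rintro rfl
            exact hvs (hs.le_of_ge hvNmax.prop (Finset.subset_insert v N)
              (Finset.mem_insert_self v N))
          · exact Finset.mem_of_mem_insert_of_ne (hs.prop.1 hw) fun h => hvs (h ▸ hw)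
          · exact hs.le_of_ge ⟨ht.1.trans (Finset.subset_insert v U), ht.2⟩ hle
      · rintro (rfl | ⟨hsN, i, rfl⟩)
        · exact hvNmax
        · have hm := (hC.cliques (C i)).1 ⟨i, rfl⟩
          refine ⟨⟨(hCU i).trans (Finset.subset_insert v U), hCcl i⟩, fun t ht hle => ?_⟩
          by_cases hvt : v ∈ t
          · exfalso
            have hle' : C i ⊆ N := fun w hw =>
              Finset.mem_of_mem_insert_of_ne (hsubN t hvt ht.1 ht.2 (hle hw)) fun h =>
                hvC i (h ▸ hw)
            exact hsN (hle'.antisymm (hm.le_of_ge ⟨hNU, hNcl⟩ hle'))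
          · exact hm.le_of_ge ⟨fun w hw => Finset.mem_of_mem_insert_of_ne (ht.1 hw)
              fun h => hvt (h ▸ hw), ht.2⟩ hle
    -- If `N` is listed, it is enlarged in place; `v` then lies in a single clique, so no separator
    -- changes. Otherwise the new clique goes to the end, with separator `N`.
    by_cases hex : ∃ t, C t = N
    · obtain ⟨t, ht⟩ := hex
      have hup : ∀ i, Function.update C t (insert v N) i ⊆ insert v (C i) ∧
          C i ⊆ Function.update C t (insert v N) i := by
        intro i
        by_cases hi : i = t
        · subst hi
          simp [ht]
        · simp [hi]
      have hvup : ∀ i, v ∈ Function.update C t (insert v N) i → i = t := by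
        intro i hi
        by_contra hit
        rw [Function.update_of_ne hit] at hi
        exact hvC i hi
      have hsep : ∀ i, separator (Function.update C t (insert v N)) i = separator C i := by
        intro i
        ext w
        rw [mem_separator, mem_separator]
        constructor
        · rintro ⟨h1, j, hj, h2⟩
          have hwv : w ≠ v := by
            rintro rfl
            exact hj.ne ((hvup j h2).trans (hvup i h1).symm)
          exact ⟨Finset.mem_of_mem_insert_of_ne ((hup i).1 h1) hwv, j, hj,
            Finset.mem_of_mem_insert_of_ne ((hup j).1 h2) hwv⟩
        · rintro ⟨h1, j, hj, h2⟩
          exact ⟨(hup i).2 h1, j, hj, (hup j).2 h2⟩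
      refine ⟨m, Function.update C t (insert v N), ⟨?_, fun s => ?_, fun i hi => ?_⟩, ?_⟩
      · intro i j hij
        by_cases hi : i = t
        · subst hi
          refine (hvup j ?_).symm
          rw [← hij, Function.update_self]
          exact Finset.mem_insert_self v N
        · by_cases hj : j = t
          · subst hj
            refine absurd (hvup i ?_) hi
            rw [hij, Function.update_self]
            exact Finset.mem_insert_self v N
          · rw [Function.update_of_ne hi, Function.update_of_ne hj] at hij
            exact hC.injective hij
      · rw [hmax]
        constructor
        · rintro ⟨i, rfl⟩
          by_cases hi : i = t
          · subst hi
            exact .inl (Function.update_self ..)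
          · refine .inr ⟨?_, i, (Function.update_of_ne hi ..).symm⟩
            rw [Function.update_of_ne hi, ← ht]
            exact fun h => hi (hC.injective h)
        · rintro (rfl | ⟨hsN, i, rfl⟩)
          · exact ⟨t, Function.update_self ..⟩
          · refine ⟨i, Function.update_of_ne ?_ ..⟩
            rintro rfl
            exact hsN ht
      · obtain ⟨j, hj, hsub⟩ := hC.rip i hi
        exact ⟨j, hj, (hsep i ▸ hsub).trans (hup j).2⟩
      · intro hcon i hi
        rw [hsep]
        exact hne (hcon.of_insert hv hcl) i hi
    · set C' : Fin (m + 1 + 1) → Finset V := Fin.snoc C (insert v N)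
      have hc (i : Fin (m + 1)) : C' i.castSucc = C i := Fin.snoc_castSucc ..
      have hl : C' (Fin.last _) = insert v N := Fin.snoc_last ..
      have hsep (i : Fin (m + 1)) : separator C' i.castSucc = separator C i := by
        rw [← separator_comp_castSucc]
        congr 1
        funext j
        exact hc j
      obtain ⟨l, hNl⟩ := hcover N hNU hNcl
      have hsepl : separator C' (Fin.last _) = N := by
        ext w
        rw [mem_separator, hl]
        constructor
        · rintro ⟨h1, j, hj, h2⟩
          refine Finset.mem_of_mem_insert_of_ne h1 ?_
          rintro rfl
          rw [← Fin.castSucc_castPred j hj.ne, hc] at h2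
          exact hvC _ h2
        · exact fun hw => ⟨Finset.mem_insert_of_mem hw, l.castSucc, Fin.castSucc_lt_last l,
            by rw [hc]; exact hNl hw⟩
      refine ⟨m + 1, C', ⟨?_, fun s => ?_, fun i hi => ?_⟩, ?_⟩
      · intro i j hij
        induction i using Fin.lastCases with
        | last =>
          induction j using Fin.lastCases with
          | last => rfl
          | cast j =>
            rw [hl, hc] at hij
            exact absurd (hij ▸ Finset.mem_insert_self v N) (hvC j)
        | cast i =>
          induction j using Fin.lastCases with
          | last =>
            rw [hl, hc] at hij
            exact absurd (hij ▸ Finset.mem_insert_self v N) (hvC i)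
          | cast j =>
            rw [hc, hc] at hij
            exact congrArg _ (hC.injective hij)
      · rw [hmax, Fin.exists_fin_succ']
        simp only [hc, hl]
        constructor
        · rintro (⟨i, rfl⟩ | rfl)
          · exact .inr ⟨fun h => hex ⟨i, h⟩, i, rfl⟩
          · exact .inl rfl
        · rintro (rfl | ⟨-, h⟩)
          · exact .inr rfl
          · exact .inl h
      · induction i using Fin.lastCases with
        | last => exact ⟨l.castSucc, Fin.castSucc_lt_last l, by rw [hsepl, hc]; exact hNl⟩
        | cast i =>
          obtain ⟨j, hj, hsub⟩ := hC.rip i (by simpa using hi)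
          exact ⟨j.castSucc, by simpa using hj, by rw [hsep, hc]; exact hsub⟩
      · intro hcon i hi
        induction i using Fin.lastCases with
        | last =>
          rw [hsepl]
          by_contra hN0
          rw [Finset.not_nonempty_iff_eq_empty] at hN0
          -- For empty `U` the list consists of ∅ = `N`, which belongs to the other case.
          have hU : U.Nonempty := by
            by_contra hU
            rw [Finset.not_nonempty_iff_eq_empty] at hU
            refine hex ⟨l, ?_⟩
            rw [hN0]
            exact Finset.subset_empty.1 (hU ▸ hCU l)
          obtain ⟨s, hs, t, ht, hst⟩ := hcon U (Finset.subset_insert v U) hU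
            (fun h => hv (h ▸ Finset.mem_insert_self v U))
          have htv : t = v := by grind
          subst htv
          have : s ∈ N := Finset.mem_filter.2 ⟨hs, hst.symm⟩
          simp [hN0] at this
        | cast i =>
          rw [hsep]
          exact hne (hcon.of_insert hv hcl) i (by simpa using hi)

end Cliques

/-! ### Assembling the factorized density -/

section Main

variable {V : Type*} [Fintype V] [DecidableEq V]

theorem IsCliqueSequenceOn.isCliqueSequence {G : SimpleGraph V} {m : ℕ}
    {C : Fin (m + 1) → Finset V} (h : IsCliqueSequenceOn G Finset.univ C) :
    IsCliqueSequence G C where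
  injective := h.injective
  cliques := by simpa using h.cliques
  rip := h.rip

omit [Fintype V] in
theorem IsCliqueSequence.isClique {G : SimpleGraph V} {m : ℕ} {C : Fin (m + 1) → Finset V}
    (h : IsCliqueSequence G C) (i : Fin (m + 1)) : G.IsClique (C i : Set V) :=
  ((h.cliques _).1 ⟨i, rfl⟩).prop

theorem IsCliqueSequence.exists_subset {G : SimpleGraph V} {m : ℕ} {C : Fin (m + 1) → Finset V}
    (h : IsCliqueSequence G C) {t : Finset V} (ht : G.IsClique (t : Set V)) : ∃ i, t ⊆ C i := by
  obtain ⟨s, hts, hs⟩ := (Set.toFinite {t : Finset V | G.IsClique (t : Set V)}).exists_le_maximal ht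
  obtain ⟨i, rfl⟩ := (h.cliques s).2 hs
  exact ⟨i, hts⟩

omit [Fintype V] in
theorem IsCliqueSequence.nonempty [Nonempty V] {G : SimpleGraph V} {m : ℕ}
    {C : Fin (m + 1) → Finset V} (h : IsCliqueSequence G C) (i : Fin (m + 1)) :
    (C i).Nonempty := by
  by_contra hi
  rw [Finset.not_nonempty_iff_eq_empty] at hi
  obtain ⟨v⟩ := ‹Nonempty V›
  have hm := (h.cliques _).1 ⟨i, rfl⟩
  have := hm.le_of_ge (y := {v}) (by simp) (by simp [hi])
  simp [hi] at this

theorem exists_isCliqueSequence_isReference {G : SimpleGraph V} (hdec : Decomposable G)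
    (hconn : G.Connected) :
    ∃ (m : ℕ) (C : Fin (m + 1) → Finset V) (k : Fin (m + 1) → V),
      IsCliqueSequence G C ∧ IsReference C k := by
  have : Nonempty V := hconn.nonempty
  obtain ⟨m, C, hC, hne⟩ := exists_isCliqueSequenceOn
    (DecomposableOn.reduces hdec (Q := ∅) (by simp) (Finset.empty_subset _))
  have hC' := hC.isCliqueSequence
  have hk : ∀ i, ∃ v ∈ C i, 0 < i → v ∈ separator C i := by
    intro i
    by_cases hi : 0 < i
    · obtain ⟨v, hv⟩ := hne (cutConnected_univ hconn) i hi
      exact ⟨v, (mem_separator.1 hv).1, fun _ => hv⟩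
    · obtain ⟨v, hv⟩ := hC'.nonempty i
      exact ⟨v, hv, fun h => absurd h hi⟩
  choose k hk using hk
  exact ⟨m, C, k, hC', (hk 0).1, fun i => (hk i).2⟩

theorem prod_phi_eq {Γ : Matrix V V ℝ} (hΓ : IsVariogram Γ) {G : SimpleGraph V} {m : ℕ}
    {C : Fin (m + 1) → Finset V} {k : Fin (m + 1) → V} (hC : IsCliqueSequence G C)
    (hk : IsReference C k) (hprec : PrecisionSupported Γ G Finset.univ) {y : V → ℝ}
    (hy : ∀ i, 0 < y i) :
    (∏ i, phi Γ (C i) (k i) y) / ∏ i : Fin m, phi Γ (separator C i.succ) (k i.succ) y =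
      y (k 0) * psi Γ Finset.univ y := by
  have hcover : Finset.univ.biUnion C = Finset.univ := by
    refine Finset.eq_univ_iff_forall.2 fun v => ?_
    obtain ⟨i, hi⟩ := hC.exists_subset (t := {v}) (by simp)
    exact Finset.mem_biUnion.2 ⟨i, Finset.mem_univ i, hi (Finset.mem_singleton_self v)⟩
  have hsep : ∀ i, 0 < i → (separator C i).Nonempty := fun i hi => ⟨k i, hk.2 i hi⟩
  have hpsi := psi_biUnion hΓ (G := G) C hC.isClique hC.rip hsep
    (fun v w hvw _ _ => by
      obtain ⟨i, hi⟩ := hC.exists_subset (t := {v, w}) (by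
        rw [Finset.coe_pair, SimpleGraph.isClique_pair]
        exact fun _ => hvw)
      exact ⟨i, hi (by simp), hi (by simp)⟩)
    (hcover ▸ hprec) y
  rw [hcover] at hpsi
  have hkC : ∀ i, k i ∈ C i := by
    intro i
    rcases (Fin.zero_le i).eq_or_lt with rfl | hi
    · exact hk.1
    · exact (mem_separator.1 (hk.2 i hi)).1
  have h1 : ∏ i, phi Γ (C i) (k i) y = (∏ i, y (k i)) * ∏ i, psi Γ (C i) y := by
    rw [← Finset.prod_mul_distrib]
    exact Finset.prod_congr rfl fun i _ => phi_eq hΓ (hkC i) hy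
  have h2 : ∏ i : Fin m, phi Γ (separator C i.succ) (k i.succ) y =
      (∏ i : Fin m, y (k i.succ)) * ∏ i : Fin m, psi Γ (separator C i.succ) y := by
    rw [← Finset.prod_mul_distrib]
    exact Finset.prod_congr rfl fun i _ => phi_eq hΓ (hk.2 _ (Fin.succ_pos i)) hy
  have p1 : 0 < ∏ i : Fin m, y (k i.succ) := Finset.prod_pos fun i _ => hy _
  have p2 : 0 < ∏ i : Fin m, psi Γ (separator C i.succ) y :=
    Finset.prod_pos fun i _ => psi_pos hΓ (hsep _ (Fin.succ_pos i)) y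
  -- Index 0 has no separator, so y_{k_0} is the only reference factor without a partner in the
  -- denominator.
  rw [h1, h2, ← hpsi, Fin.prod_univ_succ]
  field_simp

/-- Serves the faces of the cone: by 0⁻¹ = 0 both densities vanish there, whatever the reference
vertex. -/
theorem inv_sq_mul_prod_inv_eq_zero (k : V) {y : V → ℝ} {i : V} (hi : y i = 0) :
    ((y k) ^ 2)⁻¹ * ∏ j ∈ Finset.univ.erase k, (y j)⁻¹ = 0 := by
  by_cases hik : i = k
  · simp [← hik, hi]
  · rw [Finset.prod_eq_zero (Finset.mem_erase.2 ⟨hik, Finset.mem_univ i⟩) (by simp [hi]), mul_zero]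

theorem hrParetoDensity_eq_factorizedDensity {Γ : Matrix V V ℝ} (hΓ : IsVariogram Γ)
    {G : SimpleGraph V} {m : ℕ} {C : Fin (m + 1) → Finset V} {k : Fin (m + 1) → V}
    (hC : IsCliqueSequence G C) (hk : IsReference C k)
    (hprec : PrecisionSupported Γ G Finset.univ) (k₀ : V) {y : V → ℝ} (hy : ∀ i, 0 ≤ y i) :
    hrParetoDensity Γ k₀ y = factorizedDensity Γ (hrExponent Γ k₀ 1) C k y := by
  by_cases h0 : ∃ i, y i = 0
  · obtain ⟨i, hi⟩ := h0
    rw [hrParetoDensity, hrLambda, factorizedDensity, inv_sq_mul_prod_inv_eq_zero _ hi,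
      inv_sq_mul_prod_inv_eq_zero _ hi]
    simp
  · push Not at h0
    have hy' : ∀ i, 0 < y i := fun i => lt_of_le_of_ne (hy i) (h0 i).symm
    rw [hrParetoDensity, factorizedDensity, prod_phi_eq hΓ hC hk hprec hy', hrLambda_eq hΓ k₀ hy',
      ← Finset.mul_prod_erase _ _ (Finset.mem_univ (k 0))]
    have := h0 (k 0)
    field_simp

end Main

end ExtremalGraph

end

theorem corollary2 {V : Type*} [Fintype V] [DecidableEq V]
    (G : SimpleGraph V) (hdec : ExtremalGraph.Decomposable G) (hconn : G.Connected)
    (Γ : Matrix V V ℝ) (hΓ : ExtremalGraph.IsVariogram Γ) (k₀ : V)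
    {Ω : Type*} [MeasurableSpace Ω] (P : Measure Ω) [IsProbabilityMeasure P]
    (Y : Ω → V → ℝ) (hY : HasLaw Y (ExtremalGraph.hrPareto Γ k₀) P)
    (hmarkov : ExtremalGraph.PairwiseMarkov G P Y) :
    (∃ (m : ℕ) (C : Fin (m + 1) → Finset V) (k : Fin (m + 1) → V),
      ExtremalGraph.IsCliqueSequence G C ∧ ExtremalGraph.IsReference C k) ∧
    ∀ (m : ℕ) (C : Fin (m + 1) → Finset V) (k : Fin (m + 1) → V),
      ExtremalGraph.IsCliqueSequence G C → ExtremalGraph.IsReference C k →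
        (∀ y ∈ ExtremalGraph.paretoSet V, ExtremalGraph.hrParetoDensity Γ k₀ y =
          ExtremalGraph.factorizedDensity Γ (ExtremalGraph.hrExponent Γ k₀ 1) C k y) ∧
        P.map Y = (volume.restrict (ExtremalGraph.paretoSet V)).withDensity fun y =>
          ENNReal.ofReal
            (ExtremalGraph.factorizedDensity Γ (ExtremalGraph.hrExponent Γ k₀ 1) C k y) := by
  refine ⟨ExtremalGraph.exists_isCliqueSequence_isReference hdec hconn, fun m C k hC hk => ?_⟩
  have hprec := ExtremalGraph.precisionSupported_univ hΓ hY hmarkov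
  have hden : ∀ y ∈ ExtremalGraph.paretoSet V, ExtremalGraph.hrParetoDensity Γ k₀ y =
      ExtremalGraph.factorizedDensity Γ (ExtremalGraph.hrExponent Γ k₀ 1) C k y := fun y hy =>
    ExtremalGraph.hrParetoDensity_eq_factorizedDensity hΓ hC hk hprec k₀ hy.1.1
  refine ⟨hden, ?_⟩
  rw [hY.map_eq, ExtremalGraph.hrPareto]
  refine withDensity_congr_ae ?_
  filter_upwards [ae_restrict_mem ExtremalGraph.measurableSet_paretoSet] with y hy
  rw [hden y hy]
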